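/- Let $Q\in L^1_{\mathrm{loc}}(]0,\infty[)$ be complex-valued and, for $m\in\mathbb{C}$, let $$L_{m^2}=-\partial_x^2+\Big(m^2-\tfrac14\Big)\frac1{x^2}+Q(x).$$ For $k\in\mathbb{C}$ let $\mathcal{N}(L_{m^2}+k^2)$ be the space of all $g\in AC^1]0,\infty[$ (that is, $g:]0,\infty[\to\mathbb{C}$ is differentiable and $g'$ is locally absolutely continuous) with $L_{m^2}g=-k^2g$ almost everywhere on $]0,\infty[$. Put $$u_m^0(x,k)=x^{\frac12+m}\sum_{n=0}^\infty\frac{1}{n!\,\Gamma(m+n+1)}\Big(\frac{k^2x^2}{4}\Big)^n ,$$ which for $\Re(k)\ge 0$, $k\neq0$, equals $(2/k)^m\sqrt{x}\,I_m(kx)$ with $I_m$ the modified Bessel function. Let $\Re(k)\ge0$. (i) Let $\Re(m)\ge0$, $m\ne0$, and suppose that $\int_0^1x|Q(x)|\,dx<\infty$. Then every $g\in\mathcal{N}(L_{m^2}+k^2)$ satisfies $$g(x)=\mathcal{O}(x^{\frac12-\Re(m)}),\qquad \partial_xg(x)=\mathcal{O}(x^{-\frac12-\Re(m)}),\qquad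 x\to0.$$ Moreover, if $\Re(m)>0$, there is a unique $u_m(\cdot,k)\in\mathcal{N}(L_{m^2}+k^2)$ such that $$u_m(x,k)-u_m^0(x,k)=o(x^{\frac12+\Re(m)}),\qquad \partial_xu_m(x,k)-\partial_xu_m^0(x,k)=o(x^{-\frac12+\Re(m)}),\qquad x\to0,$$ and for every $g\in\mathcal{N}(L_{m^2}+k^2)$ that is linearly independent of $u_m(\cdot,k)$ the limit $$\lim_{x\to0}\frac{g(x)}{x^{\frac12-m}}$$ exists and does not vanish. (ii) Let $m=0$ and suppose that $\int_0^1x\,(1+|\ln(x)|)\,|Q(x)|\,dx<\infty$. Then every $g\in\mathcal{N}(L_0+k^2)$ satisfies $$g(x)=\mathcal{O}(x^{\frac12}\ln(x)),\qquad \partial_xg(x)=\mathcal{O}(x^{-\frac12}\ln(x)),\qquad x\to0.$$ Moreover, there is a unique $u_0(\cdot,k)\in\mathcal{N}(L_0+k^2)$ such that $$u_0(x,k)-u_0^0(x,k)=o(x^{\frac12}),\qquad \partial_xu_0(x,k)-\partial_xu_0^0(x,k)=o(x^{-\frac12}),\qquad x\to0,$$ and for every $g\in\mathcal{N}(L_0+k^2)$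 that is linearly independent of $u_0(\cdot,k)$ the limit $$\lim_{x\to0}\frac{g(x)}{x^{\frac12}\ln(x)}$$ exists and does not vanish. -/

import Mathlib

open Set Filter Topology MeasureTheory Asymptotics

namespace PerturbedBessel

/-- Locally absolutely continuous functions on `]0,∞[`: absolutely continuous on every compact
subinterval. Only the values of `f` on `]0,∞[` matter. -/
def IsAC (f : ℝ → ℂ) : Prop :=
  ∀ a b : ℝ, 0 < a → 0 < b → AbsolutelyContinuousOnInterval f a b

/-- The space `AC¹]0,∞[`: differentiable functions whose derivative is locally absolutely
continuous on `]0,∞[`. -/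
def IsAC1 (f : ℝ → ℂ) : Prop :=
  DifferentiableOn ℝ f (Ioi 0) ∧ IsAC (deriv f)

/-- The potential class `∫₀¹ x |Q(x)| dx < ∞`, `Q ∈ L¹_loc]0,∞[`. -/
def InL0 (Q : ℝ → ℂ) : Prop :=
  LocallyIntegrableOn Q (Ioi 0) ∧ IntegrableOn (fun x : ℝ => x * ‖Q x‖) (Ioo 0 1)

/-- The potential class `∫₀¹ x (1 + |ln x|) |Q(x)| dx < ∞`, `Q ∈ L¹_loc]0,∞[`. -/
def InL0Log (Q : ℝ → ℂ) : Prop :=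
  LocallyIntegrableOn Q (Ioi 0) ∧
    IntegrableOn (fun x : ℝ => x * (1 + |Real.log x|) * ‖Q x‖) (Ioo 0 1)

/-- The differential expression `L_{m²} f = -f'' + (m² - 1/4) x⁻² f + Q f`. -/
noncomputable def besselOp (Q : ℝ → ℂ) (m : ℂ) (f : ℝ → ℂ) (x : ℝ) : ℂ :=
  -deriv (deriv f) x + (m ^ 2 - 1 / 4) * (1 / (x : ℂ) ^ 2) * f x + Q x * f x

/-- Membership in the null space of `L_{m²} + k²`: functions in `AC¹]0,∞[` that satisfy
`L_{m²} g = -k² g` almost everywhere on `]0,∞[`. -/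
def IsEigensolution (Q : ℝ → ℂ) (m k : ℂ) (g : ℝ → ℂ) : Prop :=
  IsAC1 g ∧ ∀ᵐ x ∂(volume.restrict (Ioi (0 : ℝ))), besselOp Q m g x = -k ^ 2 * g x

/-- The unperturbed principal solution `u_m⁰(x,k) = x^{1/2+m} 𝐅_m(k²x²/4)`, where
`𝐅_m(w) = ∑ₙ wⁿ / (n! Γ(m+n+1))`; it equals `(2/k)^m √x I_m(kx)` if `k ≠ 0`. -/
noncomputable def u0 (m k : ℂ) (x : ℝ) : ℂ :=
  (x : ℂ) ^ (1 / 2 + m) * Complex.regularizedHGFun 0 {m + 1} (k ^ 2 * (x : ℂ) ^ 2 / 4)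

/-- The defining property of the perturbed principal solution `u_m(·,k)` for `Re m ≥ 0`: an
eigensolution with `u - u_m⁰ = o(x^{1/2+Re m})` and `u' - (u_m⁰)' = o(x^{-1/2+Re m})` at `0`. -/
def IsPrincipal (Q : ℝ → ℂ) (m k : ℂ) (u : ℝ → ℂ) : Prop :=
  IsEigensolution Q m k u ∧
    (fun x => u x - u0 m k x) =o[𝓝[>] 0] (fun x : ℝ => x ^ (1 / 2 + m.re)) ∧
    (fun x => deriv u x - deriv (u0 m k) x) =o[𝓝[>] 0] (fun x : ℝ => x ^ (-1 / 2 + m.re))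

/-- Linear independence of two functions on `]0,∞[`. -/
def IndependentOnHalfLine (g u : ℝ → ℂ) : Prop :=
  LinearIndependent ℂ ![(Ioi (0 : ℝ)).domRestrict g, (Ioi (0 : ℝ)).domRestrict u]

end PerturbedBessel

/-! The substitution g = x^{1/2+m} w turns the equation into (x^{1+2m} w')' = x^{1+2m} (Q + k²) w.
Two integrations from 0, without a singular part, give the Volterra equation w(x) = c + ∫₀ˣ
y^{-1-2m} ∫₀ʸ s^{1+2m} (Q + k²) w ds dy. Integration by parts shows that its double integral
converges absolutely if ∫ x|Q| < ∞ near 0 and Re m > 0, or under the logarithmic condition if m = 0;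
the constant k² does no harm. A contraction in a weighted sup norm then gives a solution u with
prescribed coefficient of x^{1/2+m} (`exists_eigensolution_hasLeadingCoeff`). Since u_m⁰ has the
coefficient 1/Γ(m+1), which is nonzero for Re m ≥ 0, being principal amounts to having this
coefficient (`isPrincipal_iff`).

Every other solution g is compared with u through their constant Wronskian W. One has (g/u)' = -W/u²
~ -W c⁻² x^{-1-2m}, and the right side integrates to a multiple of x^{-2m}, or of ln x if m = 0,
which dominates the constants of integration (`IsEigensolution.tendsto_div_comparison`). The limit
is a nonzero multiple of W, and W vanishes only if g is a multiple of u. For uniqueness, the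
difference of two candidates has W = o(x^{2 Re m}), hence W = 0, so it is a multiple of u with
leading coefficient 0 (`eqOn_of_hasLeadingCoeff`).

If Re m = 0 and m ≠ 0, the powers x^{1/2±m} have equal modulus and only bounds are claimed. These
come from variation of constants: both amplitudes of g stay bounded at 0
(`IsEigensolution.exists_amplitude_le`). -/

namespace AbsolutelyContinuousOnInterval

/-! ### Absolutely continuous complex-valued functions -/

/-- Absolute continuity only depends on the values on the interval. -/
theorem congr_on {X : Type*} [PseudoMetricSpace X] {f g : ℝ → X} {a b : ℝ}
    (hf : AbsolutelyContinuousOnInterval f a b) (h : EqOn f g (uIcc a b)) :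
    AbsolutelyContinuousOnInterval g a b := by
  rw [absolutelyContinuousOnInterval_iff] at hf ⊢
  intro ε hε
  obtain ⟨δ, hδ, H⟩ := hf ε hε
  refine ⟨δ, hδ, fun E hE hs => ?_⟩
  convert H E hE hs using 1
  refine Finset.sum_congr rfl fun i hi => ?_
  have := hE.1 i hi
  rw [h this.1, h this.2]

theorem lipschitz_comp {X Y : Type*} [PseudoMetricSpace X] [PseudoMetricSpace Y] {f : ℝ → X}
    {a b : ℝ} (hf : AbsolutelyContinuousOnInterval f a b) {φ : X → Y} (hφ : LipschitzWith 1 φ) :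
    AbsolutelyContinuousOnInterval (fun x => φ (f x)) a b := by
  rw [absolutelyContinuousOnInterval_iff] at hf ⊢
  intro ε hε
  obtain ⟨δ, hδ, H⟩ := hf ε hε
  refine ⟨δ, hδ, fun E hE hs => lt_of_le_of_lt ?_ (H E hE hs)⟩
  exact Finset.sum_le_sum fun i _ => by simpa using hφ.dist_le_mul (f (E.2 i).1) (f (E.2 i).2)

theorem re {f : ℝ → ℂ} {a b : ℝ} (hf : AbsolutelyContinuousOnInterval f a b) :
    AbsolutelyContinuousOnInterval (fun x => (f x).re) a b :=
  hf.lipschitz_comp (φ := Complex.re) (LipschitzWith.mk_one fun x y => by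
    simpa [Complex.dist_eq, Real.dist_eq] using Complex.abs_re_le_norm (x - y))

theorem im {f : ℝ → ℂ} {a b : ℝ} (hf : AbsolutelyContinuousOnInterval f a b) :
    AbsolutelyContinuousOnInterval (fun x => (f x).im) a b :=
  hf.lipschitz_comp (φ := Complex.im) (LipschitzWith.mk_one fun x y => by
    simpa [Complex.dist_eq, Real.dist_eq] using Complex.abs_im_le_norm (x - y))

theorem of_re_im {f : ℝ → ℂ} {a b : ℝ}
    (hr : AbsolutelyContinuousOnInterval (fun x => (f x).re) a b)
    (hi : AbsolutelyContinuousOnInterval (fun x => (f x).im) a b) :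
    AbsolutelyContinuousOnInterval f a b := by
  have h1 : AbsolutelyContinuousOnInterval (fun x => ((f x).re : ℂ)) a b :=
    hr.lipschitz_comp Complex.isometry_ofReal.lipschitz
  have h2 : AbsolutelyContinuousOnInterval (fun x => ((f x).im : ℂ)) a b :=
    hi.lipschitz_comp Complex.isometry_ofReal.lipschitz
  have h3 := h1.add (h2.const_smul Complex.I)
  refine h3.congr_on fun x _ => ?_
  simp only [Pi.add_apply, smul_eq_mul]
  rw [mul_comm, Complex.re_add_im]

theorem cmul {f g : ℝ → ℂ} {a b : ℝ} (hf : AbsolutelyContinuousOnInterval f a b)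
    (hg : AbsolutelyContinuousOnInterval g a b) :
    AbsolutelyContinuousOnInterval (fun x => f x * g x) a b := hf.smul hg

theorem _root_.IntervalIntegrable.absolutelyContinuousOnInterval_complex {f : ℝ → ℂ} {a b c : ℝ}
    (h : IntervalIntegrable f volume a b) (hc : c ∈ uIcc a b) :
    AbsolutelyContinuousOnInterval (fun x => ∫ v in c..x, f v) a b := by
  have key : ∀ x ∈ uIcc a b, IntervalIntegrable f volume c x := fun x hx =>
    h.mono_set (uIcc_subset_uIcc hc hx)
  have h1 : IntervalIntegrable (fun x => (f x).re) volume a b := ⟨h.1.re, h.2.re⟩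
  have h2 : IntervalIntegrable (fun x => (f x).im) volume a b := ⟨h.1.im, h.2.im⟩
  refine of_re_im ?_ ?_
  · refine (h1.absolutelyContinuousOnInterval_intervalIntegral hc).congr_on fun x hx => ?_
    exact Complex.reCLM.intervalIntegral_comp_comm (key x hx)
  · refine (h2.absolutelyContinuousOnInterval_intervalIntegral hc).congr_on fun x hx => ?_
    exact Complex.imCLM.intervalIntegral_comp_comm (key x hx)

theorem ae_differentiableAt_complex {f : ℝ → ℂ} {a b : ℝ}
    (hf : AbsolutelyContinuousOnInterval f a b) :
    ∀ᵐ x : ℝ, x ∈ uIcc a b → DifferentiableAt ℝ f x := by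
  filter_upwards [hf.re.ae_differentiableAt, hf.im.ae_differentiableAt] with x h1 h2 hx
  have h3 := (h1 hx).hasDerivAt.ofReal_comp
  have h4 := ((h2 hx).hasDerivAt.ofReal_comp).mul_const Complex.I
  refine (h3.add h4).differentiableAt.congr_of_eventuallyEq (Eventually.of_forall fun y => ?_)
  simp

/-- Fundamental theorem of calculus for complex-valued absolutely continuous functions. -/
theorem integral_eq_sub_of_ae_hasDerivAt {f f' : ℝ → ℂ} {a b : ℝ}
    (hf : AbsolutelyContinuousOnInterval f a b)
    (hd : ∀ᵐ x : ℝ, x ∈ uIcc a b → HasDerivAt f (f' x) x)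
    (hi : IntervalIntegrable f' volume a b) : ∫ x in a..b, f' x = f b - f a := by
  -- Subtracting the primitive of `f'` leaves an absolutely continuous function with derivative zero
  -- almost everywhere, hence a constant.
  have hg := hf.sub (hi.absolutelyContinuousOnInterval_complex (c := a) left_mem_uIcc)
  obtain ⟨C, hC⟩ := hg.const_of_ae_hasDerivAt_zero (by
    filter_upwards [hd, hi.ae_hasDerivAt_integral] with x h1 h2 hx
    simpa using (h1 hx).sub (h2 hx a left_mem_uIcc))
  have h1 := hC a left_mem_uIcc
  have h2 := hC b right_mem_uIcc
  simp only [Pi.sub_apply, intervalIntegral.integral_same, sub_zero] at h1 h2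
  rw [h1, ← h2]; ring

end AbsolutelyContinuousOnInterval

namespace PerturbedBessel

/-! ### Local absolute continuity on the half-line -/

theorem uIcc_subset_Ioi {a b : ℝ} (ha : 0 < a) (hb : 0 < b) : uIcc a b ⊆ Ioi 0 := fun _ hx =>
  lt_of_lt_of_le (lt_min ha hb) hx.1

theorem IsAC.continuousOn {f : ℝ → ℂ} (hf : IsAC f) : ContinuousOn f (Ioi 0) := by
  intro x hx
  have hx : 0 < x := hx
  have h := (hf (x / 2) (2 * x) (by positivity) (by positivity)).continuousOn
  rw [uIcc_of_le (by linarith)] at h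
  exact (h.continuousAt (Icc_mem_nhds (by linarith) (by linarith))).continuousWithinAt

theorem IsAC.congr {f g : ℝ → ℂ} (hf : IsAC f) (h : EqOn f g (Ioi 0)) : IsAC g :=
  fun a b ha hb => (hf a b ha hb).congr_on (h.mono (uIcc_subset_Ioi ha hb))

theorem IsAC.add {f g : ℝ → ℂ} (hf : IsAC f) (hg : IsAC g) : IsAC (fun x => f x + g x) :=
  fun a b ha hb => (hf a b ha hb).add (hg a b ha hb)

theorem IsAC.sub {f g : ℝ → ℂ} (hf : IsAC f) (hg : IsAC g) : IsAC (fun x => f x - g x) :=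
  fun a b ha hb => (hf a b ha hb).sub (hg a b ha hb)

theorem IsAC.mul {f g : ℝ → ℂ} (hf : IsAC f) (hg : IsAC g) : IsAC (fun x => f x * g x) :=
  fun a b ha hb => (hf a b ha hb).cmul (hg a b ha hb)

theorem IsAC.const (c : ℂ) : IsAC (fun _ => c) := fun _ _ _ _ =>
  contDiffOn_const.absolutelyContinuousOnInterval

theorem absolutelyContinuousOnInterval_of_hasDerivAt {E : Type*} [NormedAddCommGroup E]
    [NormedSpace ℝ E] {f f' : ℝ → E} (hd : ∀ x, 0 < x → HasDerivAt f (f' x) x)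
    (hc : ContinuousOn f' (Ioi 0)) {a b : ℝ} (ha : 0 < a) (hb : 0 < b) :
    AbsolutelyContinuousOnInterval f a b := by
  have : ContDiffOn ℝ 1 f (Ioi 0) := by
    rw [contDiffOn_one_iff_derivWithin (uniqueDiffOn_Ioi 0)]
    refine ⟨fun x hx => (hd x hx).differentiableAt.differentiableWithinAt, ?_⟩
    refine hc.congr fun x hx => ?_
    exact (hd x hx).hasDerivWithinAt.derivWithin (uniqueDiffOn_Ioi 0 x hx)
  exact (this.mono (uIcc_subset_Ioi ha hb)).absolutelyContinuousOnInterval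

theorem isAC_of_hasDerivAt {f f' : ℝ → ℂ} (hd : ∀ x, 0 < x → HasDerivAt f (f' x) x)
    (hc : ContinuousOn f' (Ioi 0)) : IsAC f := fun _ _ ha hb =>
  absolutelyContinuousOnInterval_of_hasDerivAt hd hc ha hb

theorem ae_Ioi_of_forall {p : ℝ → Prop}
    (h : ∀ a b : ℝ, 0 < a → 0 < b → ∀ᵐ x : ℝ, x ∈ uIcc a b → p x) :
    ∀ᵐ x : ℝ, x ∈ Ioi (0 : ℝ) → p x := by
  -- Countably many intervals [1/(n+1), n+1] exhaust the half-line, so the exceptional null sets may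
  -- be united.
  have := ae_all_iff.2 fun n : ℕ => h (1 / (n + 1)) (n + 1) (by positivity) (by positivity)
  filter_upwards [this] with x hx hx0
  have hx0 : 0 < x := hx0
  obtain ⟨n, hn⟩ := exists_nat_gt (max x (1 / x))
  have h1 : x < n := (le_max_left _ _).trans_lt hn
  have h2 : 1 / x < n := (le_max_right _ _).trans_lt hn
  refine hx n ?_
  rw [mem_uIcc]
  left
  constructor
  · rw [div_le_iff₀ (by positivity)]
    rw [div_lt_iff₀ hx0] at h2
    nlinarith
  · linarith

theorem IsAC.ae_differentiableAt {f : ℝ → ℂ} (hf : IsAC f) :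
    ∀ᵐ x : ℝ, x ∈ Ioi (0 : ℝ) → DifferentiableAt ℝ f x :=
  ae_Ioi_of_forall fun a b ha hb => (hf a b ha hb).ae_differentiableAt_complex

theorem IsAC1.hasDerivAt {f : ℝ → ℂ} (hf : IsAC1 f) {x : ℝ} (hx : 0 < x) :
    HasDerivAt f (deriv f x) x :=
  (hf.1.differentiableAt (Ioi_mem_nhds hx)).hasDerivAt

theorem IsAC1.isAC {f : ℝ → ℂ} (hf : IsAC1 f) : IsAC f :=
  isAC_of_hasDerivAt (fun _ hx => hf.hasDerivAt hx) hf.2.continuousOn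

/-! ### Eigensolutions and their Wronskian -/

/-- The coefficient `P` of the equation `g'' = P g` satisfied by eigensolutions. -/
noncomputable def schrodingerCoeff (Q : ℝ → ℂ) (m k : ℂ) (x : ℝ) : ℂ :=
  (m ^ 2 - 1 / 4) * (1 / (x : ℂ) ^ 2) + (Q x + k ^ 2)

variable {Q : ℝ → ℂ} {m k : ℂ}

theorem IsEigensolution.ae_hasDerivAt {g : ℝ → ℂ} (hg : IsEigensolution Q m k g) :
    ∀ᵐ x : ℝ, x ∈ Ioi (0 : ℝ) →
      HasDerivAt (deriv g) (schrodingerCoeff Q m k x * g x) x := by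
  filter_upwards [hg.1.2.ae_differentiableAt, (ae_restrict_iff' measurableSet_Ioi).1 hg.2]
    with x h1 h2 hx
  refine (h1 hx).hasDerivAt.congr_deriv ?_
  have := h2 hx
  simp only [besselOp, schrodingerCoeff] at this ⊢
  linear_combination -this

/-- A criterion for being an eigensolution, given candidates for both derivatives. -/
theorem isEigensolution_of_hasDerivAt {g g' : ℝ → ℂ}
    (h1 : ∀ x, 0 < x → HasDerivAt g (g' x) x) (hac : IsAC g')
    (h2 : ∀ᵐ x : ℝ, x ∈ Ioi (0 : ℝ) → HasDerivAt g' (schrodingerCoeff Q m k x * g x) x) :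
    IsEigensolution Q m k g := by
  have he : EqOn g' (deriv g) (Ioi 0) := fun x hx => (h1 x hx).deriv.symm
  refine ⟨⟨fun x hx => (h1 x hx).differentiableAt.differentiableWithinAt, hac.congr he⟩, ?_⟩
  rw [ae_restrict_iff' measurableSet_Ioi]
  filter_upwards [h2] with x h hx
  have h3 : deriv (deriv g) x = schrodingerCoeff Q m k x * g x :=
    ((h hx).congr_of_eventuallyEq
      (he.symm.eventuallyEq_of_mem (Ioi_mem_nhds hx))).deriv
  rw [besselOp, h3, schrodingerCoeff]
  ring

theorem IsEigensolution.sub_const_mul {g u : ℝ → ℂ} (hg : IsEigensolution Q m k g)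
    (hu : IsEigensolution Q m k u) (c : ℂ) :
    IsEigensolution Q m k (fun x => g x - c * u x) := by
  refine isEigensolution_of_hasDerivAt (g' := fun x => deriv g x - c * deriv u x)
    (fun x hx => (hg.1.hasDerivAt hx).sub ((hu.1.hasDerivAt hx).const_mul c))
    (hg.1.2.sub ((IsAC.const c).mul hu.1.2)) ?_
  filter_upwards [hg.ae_hasDerivAt, hu.ae_hasDerivAt] with x h1 h2 hx
  refine ((h1 hx).sub ((h2 hx).const_mul c)).congr_deriv ?_
  ring

/-- The Wronskian of two eigensolutions is constant. -/
theorem IsEigensolution.exists_wronskian_eq {g u : ℝ → ℂ} (hg : IsEigensolution Q m k g)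
    (hu : IsEigensolution Q m k u) :
    ∃ W : ℂ, ∀ x, 0 < x → g x * deriv u x - deriv g x * u x = W := by
  have hac : IsAC fun x => g x * deriv u x - deriv g x * u x :=
    (hg.1.isAC.mul hu.1.2).sub (hg.1.2.mul hu.1.isAC)
  have hd : ∀ᵐ x : ℝ, x ∈ Ioi (0 : ℝ) →
      HasDerivAt (fun x => g x * deriv u x - deriv g x * u x) 0 x := by
    filter_upwards [hg.ae_hasDerivAt, hu.ae_hasDerivAt] with x h1 h2 hx
    refine (((hg.1.hasDerivAt hx).mul (h2 hx)).sub
      ((h1 hx).mul (hu.1.hasDerivAt hx))).congr_deriv ?_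
    ring
  refine ⟨g 1 * deriv u 1 - deriv g 1 * u 1, fun x hx => ?_⟩
  obtain ⟨C, hC⟩ := (hac 1 x one_pos hx).const_of_ae_hasDerivAt_zero (by
    filter_upwards [hd] with y h hy using h (uIcc_subset_Ioi one_pos hx hy))
  exact (hC x right_mem_uIcc).trans (hC 1 left_mem_uIcc).symm

/-! ### Volterra equations with a singular endpoint -/

theorem continuousOn_primitive_Ici {E : Type*} [NormedAddCommGroup E] [NormedSpace ℝ E]
    {f : ℝ → E} (hf : ∀ b, 0 ≤ b → IntervalIntegrable f volume 0 b) :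
    ContinuousOn (fun x => ∫ s in (0 : ℝ)..x, f s) (Ici 0) := by
  intro x hx
  have hx : 0 ≤ x := hx
  have h := intervalIntegral.continuousOn_primitive_interval (f := f) (μ := volume)
    (a := 0) (b := x + 1) (by
      rw [uIcc_of_le (by linarith), integrableOn_Icc_iff_integrableOn_Ioc]
      exact (intervalIntegrable_iff_integrableOn_Ioc_of_le (by linarith)).1
        (hf (x + 1) (by linarith)))
  rw [uIcc_of_le (by linarith)] at h
  refine (h x ⟨hx, by linarith⟩).mono_of_mem_nhdsWithin ?_
  rw [← Ici_inter_Iic, inter_comm]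
  exact inter_mem (mem_nhdsWithin_of_mem_nhds (Iic_mem_nhds (by linarith))) self_mem_nhdsWithin

theorem hasDerivAt_primitive {E : Type*} [NormedAddCommGroup E] [NormedSpace ℝ E]
    [CompleteSpace E] {f : ℝ → E} (hf : ∀ b, 0 ≤ b → IntervalIntegrable f volume 0 b)
    (hc : ContinuousOn f (Ioi 0)) {x : ℝ} (hx : 0 < x) :
    HasDerivAt (fun x => ∫ s in (0 : ℝ)..x, f s) (f x) x :=
  intervalIntegral.integral_hasDerivAt_right (hf x hx.le)
    (hc.stronglyMeasurableAtFilter isOpen_Ioi x hx) (hc.continuousAt (Ioi_mem_nhds hx))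

/-- Coefficients for which the Volterra equation `w(x) = c + ∫₀ˣ p(y) ∫₀ʸ q(s) w(s) ds dy` is
well-posed up to the singular endpoint `0`. -/
structure VolterraPair (p q : ℝ → ℂ) : Prop where
  cont : ContinuousOn p (Ioi 0)
  int : ∀ b, 0 ≤ b → IntervalIntegrable q volume 0 b
  int_mul : ∀ b, 0 ≤ b →
    IntervalIntegrable (fun y => ‖p y‖ * ∫ s in (0 : ℝ)..y, ‖q s‖) volume 0 b

/-- The exponent of the weight which turns the Volterra operator into a contraction. -/
noncomputable def volterraWeight (p q : ℝ → ℂ) (x : ℝ) : ℝ :=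
  ∫ y in (0 : ℝ)..x, ‖p y‖ * ∫ s in (0 : ℝ)..y, ‖q s‖

/-- The Volterra operator `w ↦ ∫₀ˣ p(y) ∫₀ʸ q(s) w(s) ds dy`. -/
noncomputable def volterraOp (p q w : ℝ → ℂ) (x : ℝ) : ℂ :=
  ∫ y in (0 : ℝ)..x, p y * ∫ s in (0 : ℝ)..y, q s * w s

namespace VolterraPair

variable {p q w : ℝ → ℂ}

theorem continuousOn_norm_primitive (h : VolterraPair p q) :
    ContinuousOn (fun y => ∫ s in (0 : ℝ)..y, ‖q s‖) (Ici 0) :=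
  continuousOn_primitive_Ici fun b hb => (h.int b hb).norm

theorem continuousOn_weight (h : VolterraPair p q) :
    ContinuousOn (volterraWeight p q) (Ici 0) :=
  continuousOn_primitive_Ici h.int_mul

theorem hasDerivAt_weight (h : VolterraPair p q) {x : ℝ} (hx : 0 < x) :
    HasDerivAt (volterraWeight p q) (‖p x‖ * ∫ s in (0 : ℝ)..x, ‖q s‖) x :=
  hasDerivAt_primitive h.int_mul
    (h.cont.norm.mul (h.continuousOn_norm_primitive.mono Ioi_subset_Ici_self)) hx

theorem weight_zero : volterraWeight p q 0 = 0 := by simp [volterraWeight]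

theorem weight_mono (h : VolterraPair p q) : MonotoneOn (volterraWeight p q) (Ici 0) := by
  refine monotoneOn_of_deriv_nonneg (convex_Ici 0) h.continuousOn_weight ?_ ?_
  · rw [interior_Ici]
    exact fun x hx => (h.hasDerivAt_weight hx).differentiableAt.differentiableWithinAt
  · rw [interior_Ici]
    intro x hx
    rw [(h.hasDerivAt_weight hx).deriv]
    exact mul_nonneg (norm_nonneg _)
      (intervalIntegral.integral_nonneg (le_of_lt hx) fun _ _ => norm_nonneg _)

theorem weight_nonneg (h : VolterraPair p q) {x : ℝ} (hx : 0 ≤ x) :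
    0 ≤ volterraWeight p q x := by
  rw [← weight_zero (p := p) (q := q)]
  exact h.weight_mono self_mem_Ici hx hx

theorem intervalIntegrable_mul (h : VolterraPair p q) (hw : ContinuousOn w (Ici 0)) (b : ℝ)
    (hb : 0 ≤ b) : IntervalIntegrable (fun s => q s * w s) volume 0 b := by
  refine (h.int b hb).mul_continuousOn (hw.mono ?_)
  rw [uIcc_of_le hb]
  exact Icc_subset_Ici_self

theorem norm_inner_le (h : VolterraPair p q) {M y : ℝ} (hy : 0 ≤ y)
    (hM : ∀ s ∈ Icc 0 y, ‖w s‖ ≤ M) :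
    ‖∫ s in (0 : ℝ)..y, q s * w s‖ ≤ M * ∫ s in (0 : ℝ)..y, ‖q s‖ := by
  rw [← intervalIntegral.integral_const_mul]
  refine intervalIntegral.norm_integral_le_of_norm_le hy ?_ ((h.int y hy).norm.const_mul M)
  refine Eventually.of_forall fun s hs => ?_
  rw [norm_mul, mul_comm]
  exact mul_le_mul_of_nonneg_right (hM s ⟨hs.1.le, hs.2⟩) (norm_nonneg _)

theorem continuousOn_inner (h : VolterraPair p q) (hw : ContinuousOn w (Ici 0)) :
    ContinuousOn (fun y => ∫ s in (0 : ℝ)..y, q s * w s) (Ici 0) :=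
  continuousOn_primitive_Ici (h.intervalIntegrable_mul hw)

theorem continuousOn_integrand (h : VolterraPair p q) (hw : ContinuousOn w (Ici 0)) :
    ContinuousOn (fun y => p y * ∫ s in (0 : ℝ)..y, q s * w s) (Ioi 0) :=
  h.cont.mul ((h.continuousOn_inner hw).mono Ioi_subset_Ici_self)

theorem intervalIntegrable_integrand (h : VolterraPair p q) (hw : ContinuousOn w (Ici 0)) (b : ℝ)
    (hb : 0 ≤ b) :
    IntervalIntegrable (fun y => p y * ∫ s in (0 : ℝ)..y, q s * w s) volume 0 b := by
  obtain ⟨M, hM⟩ := isCompact_Icc.exists_bound_of_continuousOn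
    (hw.mono (Icc_subset_Ici_self (b := 0) (a := b)))
  have h1 := (h.int_mul b hb).const_mul M
  rw [intervalIntegrable_iff_integrableOn_Ioc_of_le hb] at h1 ⊢
  refine Integrable.mono' h1 (((h.continuousOn_integrand hw).mono
    Ioc_subset_Ioi_self).aestronglyMeasurable measurableSet_Ioc) ?_
  rw [ae_restrict_iff' measurableSet_Ioc]
  refine Eventually.of_forall fun y hy => ?_
  rw [norm_mul, mul_left_comm]
  exact mul_le_mul_of_nonneg_left
    (h.norm_inner_le hy.1.le fun s hs => hM s ⟨hs.1, hs.2.trans hy.2⟩) (norm_nonneg _)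

theorem continuousOn_op (h : VolterraPair p q) (hw : ContinuousOn w (Ici 0)) :
    ContinuousOn (volterraOp p q w) (Ici 0) :=
  continuousOn_primitive_Ici (h.intervalIntegrable_integrand hw)

theorem hasDerivAt_op (h : VolterraPair p q) (hw : ContinuousOn w (Ici 0)) {x : ℝ} (hx : 0 < x) :
    HasDerivAt (volterraOp p q w) (p x * ∫ s in (0 : ℝ)..x, q s * w s) x :=
  hasDerivAt_primitive (h.intervalIntegrable_integrand hw) (h.continuousOn_integrand hw) hx

/-- The Volterra operator halves the weighted norm. -/
theorem norm_op_le (h : VolterraPair p q) {M x : ℝ} (hx : 0 ≤ x) (hM : 0 ≤ M)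
    (hwM : ∀ s ∈ Icc 0 x, ‖w s‖ ≤ M * Real.exp (2 * volterraWeight p q s)) :
    ‖volterraOp p q w x‖ ≤ M / 2 * Real.exp (2 * volterraWeight p q x) := by
  have hsub : Icc 0 x ⊆ Ici (0 : ℝ) := Icc_subset_Ici_self
  have hce : ContinuousOn (fun y => Real.exp (2 * volterraWeight p q y)) (Icc 0 x) :=
    Real.continuous_exp.comp_continuousOn (continuousOn_const.mul (h.continuousOn_weight.mono hsub))
  have hint : IntervalIntegrable (fun y => M * Real.exp (2 * volterraWeight p q y) *
      (‖p y‖ * ∫ s in (0 : ℝ)..y, ‖q s‖)) volume 0 x := by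
    refine (h.int_mul x hx).continuousOn_mul ?_
    rw [uIcc_of_le hx]
    exact continuousOn_const.mul hce
  -- The factor 2 in the exponent is the source of the 1/2: with Φ the weight, M e^{2Φ} Φ' is the
  -- derivative of (M/2) e^{2Φ}.
  have hftc := intervalIntegral.integral_eq_sub_of_hasDerivAt_of_le hx
    (f := fun y => M / 2 * Real.exp (2 * volterraWeight p q y))
    (f' := fun y => M * Real.exp (2 * volterraWeight p q y) *
      (‖p y‖ * ∫ s in (0 : ℝ)..y, ‖q s‖)) (continuousOn_const.mul hce) (by
      intro y hy
      refine ((((h.hasDerivAt_weight hy.1).const_mul 2).exp).const_mul (M / 2)).congr_deriv ?_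
      ring) hint
  calc ‖volterraOp p q w x‖
      ≤ ∫ y in (0 : ℝ)..x, M * Real.exp (2 * volterraWeight p q y) *
          (‖p y‖ * ∫ s in (0 : ℝ)..y, ‖q s‖) := by
        refine intervalIntegral.norm_integral_le_of_norm_le hx ?_ hint
        refine Eventually.of_forall fun y hy => ?_
        rw [norm_mul, mul_left_comm]
        refine mul_le_mul_of_nonneg_left (h.norm_inner_le hy.1.le fun s hs => ?_) (norm_nonneg _)
        refine (hwM s ⟨hs.1, hs.2.trans hy.2⟩).trans (mul_le_mul_of_nonneg_left ?_ hM)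
        exact Real.exp_le_exp.2 (by
          linarith [h.weight_mono (a := s) hs.1 (b := y) (hs.1.trans hs.2) hs.2])
    _ ≤ M / 2 * Real.exp (2 * volterraWeight p q x) := by
        rw [hftc, weight_zero]
        simpa using (by positivity : 0 ≤ M / 2)

/-- The homogeneous Volterra equation has only the trivial continuous solution. -/
theorem eq_zero_of_eq_op (h : VolterraPair p q) (hw : ContinuousOn w (Ici 0))
    (he : ∀ x, 0 ≤ x → w x = volterraOp p q w x) {x : ℝ} (hx : 0 ≤ x) : w x = 0 := by
  -- At a maximum point z of |w| e^{-2Φ} on [0, x], the halving estimate gives M ≤ M/2 for the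
  -- maximal value M.
  obtain ⟨z, hz, hmax⟩ := isCompact_Icc.exists_isMaxOn (nonempty_Icc.2 hx)
    (f := fun y => ‖w y‖ * Real.exp (-(2 * volterraWeight p q y)))
    ((hw.mono Icc_subset_Ici_self).norm.mul (Real.continuous_exp.comp_continuousOn
      (continuousOn_const.mul (h.continuousOn_weight.mono Icc_subset_Ici_self)).neg))
  set M := ‖w z‖ * Real.exp (-(2 * volterraWeight p q z)) with hMdef
  have hM : 0 ≤ M := by positivity
  have hb : ∀ s ∈ Icc 0 x, ‖w s‖ ≤ M * Real.exp (2 * volterraWeight p q s) := by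
    intro s hs
    have : ‖w s‖ * Real.exp (-(2 * volterraWeight p q s)) ≤ M := hmax hs
    rwa [Real.exp_neg, ← div_eq_mul_inv, div_le_iff₀ (Real.exp_pos _)] at this
  have h1 := h.norm_op_le hz.1 hM fun s hs => hb s ⟨hs.1, hs.2.trans hz.2⟩
  rw [← he z hz.1] at h1
  have h2 : M ≤ M / 2 := by
    nth_rw 1 [hMdef]
    rwa [Real.exp_neg, ← div_eq_mul_inv, div_le_iff₀ (Real.exp_pos _)]
  have h3 : M = 0 := by linarith
  have := hb x ⟨hx, le_rfl⟩
  rw [h3, zero_mul] at this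
  exact norm_le_zero_iff.1 this

/-- Solvability of the Volterra equation. -/
theorem exists_solution (h : VolterraPair p q) (c : ℂ) :
    ∃ w : ℝ → ℂ, ContinuousOn w (Ici 0) ∧ ∀ x, 0 ≤ x → w x = c + volterraOp p q w x := by
  -- Extending the weight by 0 to negative arguments makes it continuous on ℝ, so that the Banach
  -- space of bounded continuous functions on ℝ can be used.
  set Φ : ℝ → ℝ := fun x => volterraWeight p q (max x 0) with hΦ
  have hmax : ∀ x : ℝ, 0 ≤ max x 0 := fun x => le_max_right _ _
  have hcm : Continuous fun x : ℝ => max x 0 := continuous_id.max continuous_const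
  have hΦc : Continuous Φ := h.continuousOn_weight.comp_continuous hcm hmax
  have hΦe : ∀ x, 0 ≤ x → Φ x = volterraWeight p q x := fun x hx => by simp [hΦ, hx]
  have hΦ0 : ∀ x, 0 ≤ Φ x := fun x => h.weight_nonneg (hmax x)
  -- Writing w = e^{2Φ} f turns the weighted norm of w into the sup norm of f; the fixed point is
  -- sought for f.
  let lift : BoundedContinuousFunction ℝ ℂ → ℝ → ℂ := fun f x => Real.exp (2 * Φ x) * f x
  have hlift : ∀ f, Continuous (lift f) := fun f => by
    have : Continuous fun x => Real.exp (2 * Φ x) := by fun_prop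
    exact (Complex.continuous_ofReal.comp this).mul f.continuous
  have hop : ∀ f g : BoundedContinuousFunction ℝ ℂ, ∀ x,
      ‖volterraOp p q (fun s => lift f s - lift g s) (max x 0)‖ ≤
        dist f g / 2 * Real.exp (2 * Φ x) := fun f g x => by
    refine h.norm_op_le (hmax x) dist_nonneg fun s hs => ?_
    simp only [lift]
    rw [← mul_sub, norm_mul, Complex.norm_real, Real.norm_of_nonneg (Real.exp_pos _).le,
      hΦe s hs.1, mul_comm, ← dist_eq_norm]
    exact mul_le_mul_of_nonneg_right (f.dist_coe_le_dist s) (Real.exp_pos _).le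
  have hsub : ∀ f g : BoundedContinuousFunction ℝ ℂ, ∀ x, 0 ≤ x →
      volterraOp p q (fun s => lift f s - lift g s) x =
        volterraOp p q (lift f) x - volterraOp p q (lift g) x := fun f g x hx => by
    have i1 := fun f => h.intervalIntegrable_integrand (hlift f).continuousOn x hx
    simp only [volterraOp]
    rw [← intervalIntegral.integral_sub (i1 f) (i1 g)]
    refine intervalIntegral.integral_congr fun y hy => ?_
    rw [uIcc_of_le hx] at hy
    have i2 := fun f => h.intervalIntegrable_mul (hlift f).continuousOn y hy.1
    rw [← mul_sub, ← intervalIntegral.integral_sub (i2 f) (i2 g)]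
    simp only [mul_sub]
  have hzero : ∀ x, volterraOp p q (lift 0) x = 0 := fun x => by simp [volterraOp, lift]
  have hop0 : ∀ f : BoundedContinuousFunction ℝ ℂ, ∀ x,
      ‖volterraOp p q (lift f) (max x 0)‖ ≤ ‖f‖ / 2 * Real.exp (2 * Φ x) := fun f x => by
    have := hop f 0 x
    rwa [hsub f 0 _ (hmax x), hzero, sub_zero, dist_zero_right] at this
  let F0 : BoundedContinuousFunction ℝ ℂ → ℝ → ℂ := fun f x =>
    (Real.exp (-(2 * Φ x)) : ℝ) * (c + volterraOp p q (lift f) (max x 0))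
  have hF0c : ∀ f, Continuous (F0 f) := fun f => by
    have h1 : Continuous fun x => Real.exp (-(2 * Φ x)) := by fun_prop
    have h2 : Continuous fun x => volterraOp p q (lift f) (max x 0) :=
      (h.continuousOn_op (hlift f).continuousOn).comp_continuous hcm hmax
    exact (Complex.continuous_ofReal.comp h1).mul (continuous_const.add h2)
  have hexp : ∀ x, Real.exp (-(2 * Φ x)) * Real.exp (2 * Φ x) = 1 := fun x => by
    rw [← Real.exp_add]; simp
  have hF0b : ∀ f x, ‖F0 f x‖ ≤ ‖c‖ + ‖f‖ / 2 := fun f x => by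
    simp only [F0]
    rw [norm_mul, Complex.norm_real, Real.norm_of_nonneg (Real.exp_pos _).le]
    have h1 : Real.exp (-(2 * Φ x)) ≤ 1 := Real.exp_le_one_iff.2 (by linarith [hΦ0 x])
    calc _ ≤ Real.exp (-(2 * Φ x)) * (‖c‖ + ‖f‖ / 2 * Real.exp (2 * Φ x)) :=
          mul_le_mul_of_nonneg_left ((norm_add_le _ _).trans (by gcongr; exact hop0 f x))
            (Real.exp_pos _).le
      _ = Real.exp (-(2 * Φ x)) * ‖c‖ + ‖f‖ / 2 := by linear_combination ‖f‖ / 2 * hexp x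
      _ ≤ _ := by nlinarith [norm_nonneg c]
  let F : BoundedContinuousFunction ℝ ℂ → BoundedContinuousFunction ℝ ℂ := fun f =>
    BoundedContinuousFunction.ofNormedAddCommGroup (F0 f) (hF0c f) _ (hF0b f)
  have hF : ContractingWith (1 / 2) F := by
    refine ⟨by
      rw [← NNReal.coe_lt_coe]
      norm_num, LipschitzWith.of_dist_le_mul fun f g => ?_⟩
    rw [BoundedContinuousFunction.dist_le (by positivity)]
    intro x
    change dist (F0 f x) (F0 g x) ≤ _
    simp only [F0]
    rw [dist_eq_norm, ← mul_sub, add_sub_add_left_eq_sub, ← hsub f g _ (hmax x), norm_mul,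
      Complex.norm_real, Real.norm_of_nonneg (Real.exp_pos _).le]
    calc _ ≤ Real.exp (-(2 * Φ x)) * (dist f g / 2 * Real.exp (2 * Φ x)) :=
          mul_le_mul_of_nonneg_left (hop f g x) (Real.exp_pos _).le
      _ = dist f g / 2 := by linear_combination dist f g / 2 * hexp x
      _ = _ := by simp; ring
  set f := hF.fixedPoint F
  have hfix : F f = f := hF.fixedPoint_isFixedPt
  refine ⟨lift f, (hlift f).continuousOn, fun x hx => ?_⟩
  have h1 : F0 f x = f x := congrArg (fun g : BoundedContinuousFunction ℝ ℂ => g x) hfix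
  change (Real.exp (2 * Φ x) : ℂ) * f x = _
  rw [← h1]
  simp only [F0]
  rw [max_eq_left hx, ← mul_assoc, ← Complex.ofReal_mul, mul_comm (Real.exp _), hexp]
  simp

end VolterraPair

/-! ### Uniqueness for the Cauchy problem away from the endpoint -/

theorem intervalIntegrable_of_locallyIntegrableOn (hQ : LocallyIntegrableOn Q (Ioi 0)) {a b : ℝ}
    (ha : 0 < a) (hb : 0 < b) : IntervalIntegrable Q volume a b :=
  (hQ.integrableOn_compact_subset (uIcc_subset_Ioi ha hb) isCompact_uIcc).intervalIntegrable

theorem intervalIntegrable_schrodingerCoeff (hQ : LocallyIntegrableOn Q (Ioi 0)) {a b : ℝ}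
    (ha : 0 < a) (hb : 0 < b) : IntervalIntegrable (schrodingerCoeff Q m k) volume a b := by
  have h1 : ContinuousOn (fun x : ℝ => (m ^ 2 - 1 / 4) * (1 / (x : ℂ) ^ 2)) (uIcc a b) := by
    refine continuousOn_const.mul (continuousOn_const.div (by fun_prop) fun x hx => ?_)
    have : x ≠ 0 := (uIcc_subset_Ioi ha hb hx).ne'
    exact pow_ne_zero _ (by exact_mod_cast this)
  exact h1.intervalIntegrable.add
    ((intervalIntegrable_of_locallyIntegrableOn hQ ha hb).add intervalIntegrable_const)

theorem IsEigensolution.integral_deriv {g : ℝ → ℂ} (hg : IsEigensolution Q m k g) {a b : ℝ}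
    (ha : 0 < a) (hb : 0 < b) : ∫ x in a..b, deriv g x = g b - g a :=
  intervalIntegral.integral_eq_sub_of_hasDerivAt
    (fun _ hx => hg.1.hasDerivAt (uIcc_subset_Ioi ha hb hx))
    (hg.1.2.continuousOn.mono (uIcc_subset_Ioi ha hb)).intervalIntegrable

theorem IsEigensolution.integral_coeff_mul {g : ℝ → ℂ} (hg : IsEigensolution Q m k g)
    (hQ : LocallyIntegrableOn Q (Ioi 0)) {a b : ℝ} (ha : 0 < a) (hb : 0 < b) :
    ∫ x in a..b, schrodingerCoeff Q m k x * g x = deriv g b - deriv g a := by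
  refine (hg.1.2 a b ha hb).integral_eq_sub_of_ae_hasDerivAt ?_ ?_
  · filter_upwards [hg.ae_hasDerivAt] with x h hx using h (uIcc_subset_Ioi ha hb hx)
  · exact (intervalIntegrable_schrodingerCoeff hQ ha hb).mul_continuousOn
      (hg.1.isAC.continuousOn.mono (uIcc_subset_Ioi ha hb))

/-- An eigensolution with vanishing Cauchy data at `a` vanishes to the right of `a`. -/
theorem IsEigensolution.eq_zero_of_cauchy {g : ℝ → ℂ} (hg : IsEigensolution Q m k g)
    (hQ : LocallyIntegrableOn Q (Ioi 0)) {a : ℝ} (ha : 0 < a) (h0 : g a = 0)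
    (h1 : deriv g a = 0) {x : ℝ} (hx : a ≤ x) : g x = 0 := by
  -- Translated by `a`, zero Cauchy data make g a solution of the homogeneous Volterra equation with
  -- outer coefficient 1.
  set q : ℝ → ℂ := fun s => schrodingerCoeff Q m k (s + a)
  have hq : ∀ b, 0 ≤ b → IntervalIntegrable q volume 0 b := fun b hb => by
    have := (intervalIntegrable_schrodingerCoeff (m := m) (k := k) hQ ha
      (by linarith : 0 < b + a)).comp_add_right a
    simpa using this
  have hpair : VolterraPair (fun _ => 1) q := by
    refine ⟨continuousOn_const, hq, fun b hb => ContinuousOn.intervalIntegrable ?_⟩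
    rw [uIcc_of_le hb]
    exact continuousOn_const.mul ((continuousOn_primitive_Ici fun b hb => (hq b hb).norm).mono
      Icc_subset_Ici_self)
  have hw : ContinuousOn (fun s => g (s + a)) (Ici 0) :=
    hg.1.isAC.continuousOn.comp (by fun_prop) fun s hs => by
      have : 0 ≤ s := hs
      exact (by linarith : 0 < s + a)
  have := hpair.eq_zero_of_eq_op hw (x := x - a) (fun y hy => ?_) (by linarith)
  · simpa using this
  · have hin : ∀ t, 0 ≤ t → ∫ s in (0 : ℝ)..t, q s * g (s + a) = deriv g (t + a) := fun t ht => by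
      have := intervalIntegral.integral_comp_add_right (a := 0) (b := t)
        (fun s => schrodingerCoeff Q m k s * g s) a
      simp only [q]
      rw [this, zero_add, hg.integral_coeff_mul hQ ha (by linarith), h1, sub_zero]
    rw [volterraOp, intervalIntegral.integral_congr (g := fun t => deriv g (t + a))
      (fun t ht => by
        rw [uIcc_of_le hy] at ht
        simpa using hin t ht.1), intervalIntegral.integral_comp_add_right (fun t => deriv g t),
      zero_add, hg.integral_deriv ha (by linarith), h0, sub_zero]

/-- An eigensolution vanishing near the endpoint `0` vanishes identically. -/
theorem IsEigensolution.eq_zero_of_eventually {g : ℝ → ℂ} (hg : IsEigensolution Q m k g)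
    (hQ : LocallyIntegrableOn Q (Ioi 0)) (h : ∀ᶠ x in 𝓝[>] (0 : ℝ), g x = 0) {x : ℝ}
    (hx : 0 < x) : g x = 0 := by
  obtain ⟨δ, hδ, H⟩ := mem_nhdsGT_iff_exists_Ioo_subset.1 h
  have hδ : 0 < δ := hδ
  by_cases hxδ : x < δ
  · exact H ⟨hx, hxδ⟩
  · refine hg.eq_zero_of_cauchy hQ (half_pos hδ) (H ⟨by linarith, by linarith⟩) ?_
      (by linarith : δ / 2 ≤ x)
    have : g =ᶠ[𝓝 (δ / 2)] fun _ => 0 := by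
      filter_upwards [Ioo_mem_nhds (half_pos hδ) (half_lt_self hδ)] with y hy using H hy
    rw [this.deriv_eq]
    simp

/-! ### Integrability at the endpoint -/

/-- Integrability of `p(y) ∫₀ʸ ‖q‖` through integration by parts, where `-G' = ‖p‖`. -/
theorem intervalIntegrable_norm_mul_primitive {p q : ℝ → ℂ} {G : ℝ → ℝ} {b : ℝ} (hb : 0 < b)
    (hp : ContinuousOn p (Ioi 0)) (hq : ∀ b, 0 ≤ b → IntervalIntegrable q volume 0 b)
    (hG : ∀ x, 0 < x → HasDerivAt G (-‖p x‖) x) (hGb : 0 ≤ G b)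
    (hi : IntervalIntegrable (fun s => G s * ‖q s‖) volume 0 b) :
    IntervalIntegrable (fun y => ‖p y‖ * ∫ s in (0 : ℝ)..y, ‖q s‖) volume 0 b := by
  set φ : ℝ → ℝ := fun y => ∫ s in (0 : ℝ)..y, ‖q s‖ with hφ
  have hφc : ContinuousOn φ (Ici 0) := continuousOn_primitive_Ici fun b hb => (hq b hb).norm
  have hφ0 : ∀ y, 0 ≤ y → 0 ≤ φ y := fun y hy =>
    intervalIntegral.integral_nonneg hy fun _ _ => norm_nonneg _
  have hanti : ∀ x y, 0 < x → x ≤ y → G y ≤ G x := fun x y hx hxy => by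
    refine antitoneOn_of_deriv_nonpos (convex_Ioi 0)
      (fun z hz => (hG z hz).continuousAt.continuousWithinAt) ?_ ?_ hx
      (lt_of_lt_of_le hx hxy) hxy
    · rw [interior_Ioi]
      exact fun z hz => (hG z hz).differentiableAt.differentiableWithinAt
    · rw [interior_Ioi]
      intro z hz
      rw [(hG z hz).deriv]
      simp
  have hcont : ContinuousOn (fun y => ‖p y‖ * φ y) (Ioi 0) :=
    hp.norm.mul (hφc.mono Ioi_subset_Ici_self)
  -- On [ε, b] integration by parts gives ∫ ‖p‖φ = ∫ G‖q‖ + G(ε)φ(ε) - G(b)φ(b). The last term has a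
  -- favourable sign, and the boundary term at ε is absorbed by the missing piece of ∫ G‖q‖ over [0,
  -- ε].
  have key : ∀ ε, 0 < ε → ε ≤ b →
      ∫ y in ε..b, ‖‖p y‖ * φ y‖ ≤ ∫ s in (0 : ℝ)..b, G s * ‖q s‖ := by
    intro ε hε hεb
    have hsub : uIcc ε b ⊆ Ioi 0 := uIcc_subset_Ioi hε hb
    have hi1 : IntervalIntegrable (fun s => G s * ‖q s‖) volume 0 ε :=
      hi.mono_set (uIcc_subset_uIcc left_mem_uIcc (mem_uIcc_of_le hε.le hεb))
    have hi2 : IntervalIntegrable (fun s => G s * ‖q s‖) volume ε b :=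
      hi.mono_set (uIcc_subset_uIcc (mem_uIcc_of_le hε.le hεb) right_mem_uIcc)
    have hi3 : IntervalIntegrable (fun y => ‖p y‖ * φ y) volume ε b :=
      (hcont.mono hsub).intervalIntegrable
    have acG : AbsolutelyContinuousOnInterval G ε b :=
      absolutelyContinuousOnInterval_of_hasDerivAt hG hp.norm.neg hε hb
    have acφ : AbsolutelyContinuousOnInterval φ ε b :=
      ((hq b hb.le).norm.absolutelyContinuousOnInterval_intervalIntegral
        left_mem_uIcc).mono (uIcc_subset_uIcc (mem_uIcc_of_le hε.le hεb) right_mem_uIcc)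
    have hparts := acG.integral_deriv_mul_eq_sub acφ
    have hae : ∫ y in ε..b, (deriv G y * φ y + G y * deriv φ y) =
        ∫ y in ε..b, (G y * ‖q y‖ - ‖p y‖ * φ y) := by
      refine intervalIntegral.integral_congr_ae ?_
      filter_upwards [(hq b hb.le).norm.ae_hasDerivAt_integral] with y hy hyε
      rw [uIoc_of_le hεb] at hyε
      have hd : deriv φ y = ‖q y‖ :=
        (hy (mem_uIcc_of_le (hε.trans hyε.1).le hyε.2) 0 left_mem_uIcc).deriv
      rw [hd, (hG y (hε.trans hyε.1)).deriv]
      ring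
    rw [hae, intervalIntegral.integral_sub hi2 hi3] at hparts
    have hnorm : ∫ y in ε..b, ‖‖p y‖ * φ y‖ = ∫ y in ε..b, ‖p y‖ * φ y := by
      refine intervalIntegral.integral_congr fun y hy => ?_
      exact Real.norm_of_nonneg (mul_nonneg (norm_nonneg _) (hφ0 y (le_of_lt (hsub hy))))
    -- G is decreasing, so G(ε) ≤ G(s) under the integral defining φ(ε).
    have hstart : G ε * φ ε ≤ ∫ s in (0 : ℝ)..ε, G s * ‖q s‖ := by
      rw [hφ, ← intervalIntegral.integral_const_mul]
      refine intervalIntegral.integral_mono_on_of_le_Ioo hε.le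
        ((hq ε hε.le).norm.const_mul _) hi1 fun s hs => ?_
      exact mul_le_mul_of_nonneg_right (hanti s ε hs.1 hs.2.le) (norm_nonneg _)
    rw [hnorm, ← intervalIntegral.integral_add_adjacent_intervals hi1 hi2]
    have := mul_nonneg hGb (hφ0 b hb.le)
    linarith
  rw [intervalIntegrable_iff_integrableOn_Ioc_of_le hb.le]
  have hlim : Tendsto (fun n : ℕ => b / ((n : ℝ) + 1)) atTop (𝓝 0) :=
    tendsto_const_div_atTop_nhds_zero_nat b |>.comp (tendsto_add_atTop_nat 1) |>.congr
      fun n => by simp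
  have hpos : ∀ n : ℕ, 0 < b / ((n : ℝ) + 1) := fun n => by positivity
  have hle : ∀ n : ℕ, b / ((n : ℝ) + 1) ≤ b := fun n =>
    div_le_self hb.le (by linarith [(Nat.cast_nonneg n : (0 : ℝ) ≤ n)])
  refine integrableOn_Ioc_of_intervalIntegral_norm_bounded_left (l := atTop)
    (I := ∫ s in (0 : ℝ)..b, G s * ‖q s‖) (a := fun n : ℕ => b / ((n : ℝ) + 1)) ?_ hlim ?_
  · intro n
    rw [← intervalIntegrable_iff_integrableOn_Ioc_of_le (hle n)]
    exact (hcont.mono (uIcc_subset_Ioi (hpos n) hb)).intervalIntegrable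
  · refine Eventually.of_forall fun n => ?_
    rw [← intervalIntegral.integral_of_le (hle n)]
    exact key _ (hpos n) (hle n)

/-- Integrability at `0` of a weight times the potential shifted by a constant. -/
theorem intervalIntegrable_weight_mul {ℓ κ : ℝ → ℝ} (hℓ : Continuous ℓ)
    (hQ : LocallyIntegrableOn Q (Ioi 0)) (hκ : IntegrableOn (fun x => κ x * ‖Q x‖) (Ioo 0 1))
    (hle : ∀ x ∈ Ioo (0 : ℝ) 1, |ℓ x| ≤ κ x) (k : ℂ) (b : ℝ) (hb : 0 ≤ b) :
    IntervalIntegrable (fun x => (ℓ x : ℂ) * (Q x + k)) volume 0 b := by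
  have hℓ' : Continuous fun x => (ℓ x : ℂ) := Complex.continuous_ofReal.comp hℓ
  have h1 : IntegrableOn (fun x => (ℓ x : ℂ) * Q x) (Ioo 0 1) := by
    refine Integrable.mono' hκ (hℓ'.aestronglyMeasurable.mul
      (hQ.aestronglyMeasurable.mono_set Ioo_subset_Ioi_self)) ?_
    rw [ae_restrict_iff' measurableSet_Ioo]
    refine Eventually.of_forall fun x hx => ?_
    rw [norm_mul, Complex.norm_real]
    exact mul_le_mul_of_nonneg_right (hle x hx) (norm_nonneg _)
  have h2 : IntegrableOn (fun x => (ℓ x : ℂ) * Q x) (Icc 1 (max b 1)) :=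
    (hQ.integrableOn_compact_subset (fun x hx => lt_of_lt_of_le one_pos hx.1)
      isCompact_Icc).continuousOn_mul hℓ'.continuousOn isCompact_Icc
  have h3 : IntervalIntegrable (fun x => (ℓ x : ℂ) * Q x) volume 0 b := by
    rw [intervalIntegrable_iff_integrableOn_Ioc_of_le hb]
    refine (h1.union h2).mono_set fun x hx => ?_
    by_cases hx1 : x < 1
    · exact Or.inl ⟨hx.1, hx1⟩
    · exact Or.inr ⟨not_lt.1 hx1, hx.2.trans (le_max_left _ _)⟩
  have h4 : IntervalIntegrable (fun x => (ℓ x : ℂ) * k) volume 0 b :=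
    (hℓ'.mul continuous_const).intervalIntegrable _ _
  simpa only [mul_add] using h3.add h4

theorem hasDerivAt_cpow {x : ℝ} (hx : 0 < x) (r : ℂ) :
    HasDerivAt (fun y : ℝ => (y : ℂ) ^ r) (r * (x : ℂ) ^ (r - 1)) x := by
  by_cases hr : r = 0
  · subst hr
    simpa using hasDerivAt_const x (1 : ℂ)
  · exact hasDerivAt_ofReal_cpow_const hx.ne' hr

theorem continuousOn_cpow (r : ℂ) : ContinuousOn (fun y : ℝ => (y : ℂ) ^ r) (Ioi 0) :=
  fun _ hx => (hasDerivAt_cpow hx r).continuousAt.continuousWithinAt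

theorem isAC_cpow (r : ℂ) : IsAC (fun y : ℝ => (y : ℂ) ^ r) :=
  isAC_of_hasDerivAt (fun _ hx => hasDerivAt_cpow hx r)
    (continuousOn_const.mul (continuousOn_cpow (r - 1)))

theorem ofReal_cpow_ne_zero {x : ℝ} (hx : 0 < x) (r : ℂ) : (x : ℂ) ^ r ≠ 0 := by
  rw [Complex.cpow_def_of_ne_zero (by exact_mod_cast hx.ne')]
  exact Complex.exp_ne_zero _

/-! ### Construction of the solution with prescribed leading coefficient -/

/-- The inner coefficient `s^{1+2m} (Q(s) + k²)` of the Volterra equation of the principal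
solution. -/
noncomputable def innerCoeff (Q : ℝ → ℂ) (m k : ℂ) (s : ℝ) : ℂ :=
  (s : ℂ) ^ (2 * m) * ((s : ℂ) * (Q s + k ^ 2))

/-- The outer coefficient `y^{-1-2m}` of the Volterra equation of the principal solution. -/
noncomputable def outerCoeff (m : ℂ) (y : ℝ) : ℂ := (y : ℂ) ^ (-1 - 2 * m)

theorem norm_innerCoeff {s : ℝ} (hs : 0 < s) :
    ‖innerCoeff Q m k s‖ = s ^ (2 * m.re) * ‖(s : ℂ) * (Q s + k ^ 2)‖ := by
  rw [innerCoeff, norm_mul, Complex.norm_cpow_eq_rpow_re_of_pos hs]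
  simp

theorem norm_outerCoeff {y : ℝ} (hy : 0 < y) : ‖outerCoeff m y‖ = y ^ (-1 - 2 * m.re) := by
  rw [outerCoeff, Complex.norm_cpow_eq_rpow_re_of_pos hy]
  simp

theorem intervalIntegrable_innerCoeff (hm : 0 ≤ m.re)
    (hi : ∀ b, 0 ≤ b → IntervalIntegrable (fun x : ℝ => (x : ℂ) * (Q x + k ^ 2)) volume 0 b)
    (b : ℝ) (hb : 0 ≤ b) : IntervalIntegrable (innerCoeff Q m k) volume 0 b := by
  have h := hi b hb
  rw [intervalIntegrable_iff_integrableOn_Ioc_of_le hb] at h ⊢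
  refine Integrable.mono' (h.norm.const_mul (b ^ (2 * m.re)))
    ((((continuousOn_cpow (2 * m)).mono Ioc_subset_Ioi_self).aestronglyMeasurable
      measurableSet_Ioc).mul h.aestronglyMeasurable) ?_
  rw [ae_restrict_iff' measurableSet_Ioc]
  refine Eventually.of_forall fun s hs => ?_
  change ‖innerCoeff Q m k s‖ ≤ _
  rw [norm_innerCoeff hs.1]
  exact mul_le_mul_of_nonneg_right
    (Real.rpow_le_rpow hs.1.le hs.2 (by positivity)) (norm_nonneg _)

/-- The antiderivative G = y^{-2 Re m} / (2 Re m) cancels the factor s^{2 Re m} of the inner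
coefficient, so that G‖q‖ is a constant times |s (Q + k²)|. -/
theorem volterraPair_of_re_pos (hm : 0 < m.re)
    (hi : ∀ b, 0 ≤ b → IntervalIntegrable (fun x : ℝ => (x : ℂ) * (Q x + k ^ 2)) volume 0 b) :
    VolterraPair (outerCoeff m) (innerCoeff Q m k) := by
  have hq := intervalIntegrable_innerCoeff hm.le hi
  refine ⟨continuousOn_cpow _, hq, fun b hb => ?_⟩
  rcases hb.eq_or_lt with rfl | hb
  · exact IntervalIntegrable.refl
  refine intervalIntegrable_norm_mul_primitive (G := fun y => y ^ (-(2 * m.re)) / (2 * m.re))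
    hb (continuousOn_cpow _) hq (fun x hx => ?_) (by positivity) ?_
  · rw [norm_outerCoeff hx]
    refine ((Real.hasDerivAt_rpow_const (p := -(2 * m.re)) (Or.inl hx.ne')).div_const
      (2 * m.re)).congr_deriv ?_
    rw [show -(2 * m.re) - 1 = -1 - 2 * m.re by ring]
    field_simp
  · refine ((hi b hb.le).norm.const_mul (1 / (2 * m.re))).congr_ae ?_
    rw [Filter.EventuallyEq, ae_restrict_iff' measurableSet_uIoc]
    refine Eventually.of_forall fun s hs => ?_
    rw [uIoc_of_le hb.le] at hs
    rw [norm_innerCoeff hs.1, Real.rpow_neg hs.1.le]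
    have : s ^ (2 * m.re) ≠ 0 := (Real.rpow_pos_of_pos hs.1 _).ne'
    field_simp

/-- Here the outer coefficient is 1/y and its antiderivative is a logarithm, which is why the
stronger condition on the potential enters. The additive constant log b makes G nonnegative on ]0,
b]. -/
theorem volterraPair_zero
    (hi : ∀ b, 0 ≤ b → IntervalIntegrable (fun x : ℝ => (x : ℂ) * (Q x + k ^ 2)) volume 0 b)
    (hl : ∀ b, 0 ≤ b → IntervalIntegrable
      (fun x : ℝ => ((x * Real.log x : ℝ) : ℂ) * (Q x + k ^ 2)) volume 0 b) :
    VolterraPair (outerCoeff 0) (innerCoeff Q 0 k) := by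
  have hq := intervalIntegrable_innerCoeff (m := 0) le_rfl hi
  refine ⟨continuousOn_cpow _, hq, fun b hb => ?_⟩
  rcases hb.eq_or_lt with rfl | hb
  · exact IntervalIntegrable.refl
  refine intervalIntegrable_norm_mul_primitive (G := fun y => Real.log b - Real.log y)
    hb (continuousOn_cpow _) hq (fun x hx => ?_) (by simp) ?_
  · rw [norm_outerCoeff hx]
    refine ((Real.hasDerivAt_log hx.ne').const_sub (Real.log b)).congr_deriv ?_
    simp [Real.rpow_neg_one]
  · have h := ((hi b hb.le).const_mul (Real.log b : ℂ)).sub (hl b hb.le)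
    refine h.norm.congr_ae ?_
    rw [Filter.EventuallyEq, ae_restrict_iff' measurableSet_uIoc]
    refine Eventually.of_forall fun s hs => ?_
    rw [uIoc_of_le hb.le] at hs
    rw [norm_innerCoeff hs.1]
    have h1 : 0 ≤ Real.log b - Real.log s := sub_nonneg.2 (Real.log_le_log hs.1 hs.2)
    have h2 : (Real.log b : ℂ) * ((s : ℂ) * (Q s + k ^ 2)) -
        ((s * Real.log s : ℝ) : ℂ) * (Q s + k ^ 2) =
        ((Real.log b - Real.log s : ℝ) : ℂ) * ((s : ℂ) * (Q s + k ^ 2)) := by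
      push_cast; ring
    rw [h2, norm_mul, Complex.norm_real, Real.norm_of_nonneg h1]
    simp

/-- Leading behaviour `u ~ c x^{1/2+m}`, `u' ~ (1/2+m) c x^{-1/2+m}` at the endpoint `0`. -/
def HasLeadingCoeff (m c : ℂ) (u : ℝ → ℂ) : Prop :=
  Tendsto (fun x : ℝ => u x / (x : ℂ) ^ (1 / 2 + m)) (𝓝[>] 0) (𝓝 c) ∧
    Tendsto (fun x : ℝ => deriv u x / (x : ℂ) ^ (-1 / 2 + m)) (𝓝[>] 0) (𝓝 ((1 / 2 + m) * c))

/-- The solution is u = x^{1/2+m} w with w solving the Volterra equation with constant c. The inner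
integral V equals x^{1+2m} w', and since w(0) = c, the leading coefficient of u is c. -/
theorem exists_eigensolution_hasLeadingCoeff (hm : 0 ≤ m.re)
    (hi : ∀ b, 0 ≤ b → IntervalIntegrable (fun x : ℝ => (x : ℂ) * (Q x + k ^ 2)) volume 0 b)
    (hpair : VolterraPair (outerCoeff m) (innerCoeff Q m k)) (c : ℂ) :
    ∃ u, IsEigensolution Q m k u ∧ HasLeadingCoeff m c u := by
  obtain ⟨w, hwc, hw⟩ := hpair.exists_solution c
  set V : ℝ → ℂ := fun x => ∫ s in (0 : ℝ)..x, innerCoeff Q m k s * w s with hV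
  have hVi := hpair.intervalIntegrable_mul hwc
  have hwd : ∀ x, 0 < x → HasDerivAt w (outerCoeff m x * V x) x := fun x hx => by
    refine ((hpair.hasDerivAt_op hwc hx).const_add c).congr_of_eventuallyEq ?_
    filter_upwards [Ioi_mem_nhds hx] with y hy using hw y (le_of_lt hy)
  have hVac : IsAC V := fun a b ha hb =>
    ((hVi (max a b) (ha.le.trans (le_max_left _ _))).absolutelyContinuousOnInterval_complex
      left_mem_uIcc).mono (uIcc_subset_uIcc
        (mem_uIcc_of_le ha.le (le_max_left _ _)) (mem_uIcc_of_le hb.le (le_max_right _ _)))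
  have hVd : ∀ᵐ x : ℝ, x ∈ Ioi (0 : ℝ) → HasDerivAt V (innerCoeff Q m k x * w x) x := by
    refine ae_Ioi_of_forall fun a b ha hb => ?_
    have hab : 0 ≤ max a b := ha.le.trans (le_max_left _ _)
    filter_upwards [(hVi (max a b) hab).ae_hasDerivAt_integral] with x hx hxab
    exact hx (mem_uIcc_of_le (le_of_lt (uIcc_subset_Ioi ha hb hxab)) hxab.2) 0 left_mem_uIcc
  have hwac : IsAC w := isAC_of_hasDerivAt hwd ((continuousOn_cpow _).mul hVac.continuousOn)
  set u : ℝ → ℂ := fun x => (x : ℂ) ^ (1 / 2 + m) * w x with hu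
  set u' : ℝ → ℂ := fun x => (1 / 2 + m) * ((x : ℂ) ^ (-1 / 2 + m) * w x) +
    (x : ℂ) ^ (-1 / 2 - m) * V x with hu'
  have hud : ∀ x, 0 < x → HasDerivAt u (u' x) x := fun x hx => by
    have hx0 : (x : ℂ) ≠ 0 := by exact_mod_cast hx.ne'
    refine ((hasDerivAt_cpow hx (1 / 2 + m)).mul (hwd x hx)).congr_deriv ?_
    have e1 : (x : ℂ) ^ (1 / 2 + m - 1) = (x : ℂ) ^ (-1 / 2 + m) := by congr 1; ring
    have e2 : (x : ℂ) ^ (1 / 2 + m) * outerCoeff m x = (x : ℂ) ^ (-1 / 2 - m) := by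
      rw [outerCoeff, ← Complex.cpow_add _ _ hx0]; congr 1; ring
    simp only [hu']
    rw [e1, ← e2]
    ring
  refine ⟨u, isEigensolution_of_hasDerivAt hud
    (((IsAC.const _).mul ((isAC_cpow _).mul hwac)).add ((isAC_cpow _).mul hVac)) ?_, ?_, ?_⟩
  · filter_upwards [hVd] with x hVx hx
    have hx : 0 < x := hx
    have hx0 : (x : ℂ) ≠ 0 := by exact_mod_cast hx.ne'
    refine ((((hasDerivAt_cpow hx (-1 / 2 + m)).mul (hwd x hx)).const_mul (1 / 2 + m)).add
      ((hasDerivAt_cpow hx (-1 / 2 - m)).mul (hVx hx))).congr_deriv ?_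
    have e1 : (x : ℂ) ^ (1 / 2 + m) = (x : ℂ) ^ (-1 / 2 + m - 1) * x ^ 2 := by
      rw [← Complex.cpow_natCast, ← Complex.cpow_add _ _ hx0]; congr 1; push_cast; ring
    have e2 : (x : ℂ) ^ (-1 / 2 + m) * outerCoeff m x = (x : ℂ) ^ (-1 / 2 - m - 1) := by
      rw [outerCoeff, ← Complex.cpow_add _ _ hx0]; congr 1; ring
    have e3 : (x : ℂ) ^ (-1 / 2 - m) * innerCoeff Q m k x =
        (x : ℂ) ^ (1 / 2 + m) * (Q x + k ^ 2) := by
      rw [innerCoeff, ← mul_assoc, ← Complex.cpow_add _ _ hx0, ← mul_assoc]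
      nth_rewrite 2 [← Complex.cpow_one (x : ℂ)]
      rw [← Complex.cpow_add _ _ hx0]
      congr 2; ring
    have e4 : (m ^ 2 - 1 / 4) * (1 / (x : ℂ) ^ 2) * (x : ℂ) ^ (1 / 2 + m) =
        (m ^ 2 - 1 / 4) * (x : ℂ) ^ (-1 / 2 + m - 1) := by
      rw [e1]; field_simp
    simp only [schrodingerCoeff, hu]
    linear_combination (1 / 2 + m) * V x * e2 + w x * e3 - w x * e4
  · have h0 : Tendsto w (𝓝[>] 0) (𝓝 (w 0)) :=
      (hwc 0 self_mem_Ici).mono_left (nhdsWithin_mono _ Ioi_subset_Ici_self)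
    rw [hw 0 le_rfl] at h0
    simp only [volterraOp, intervalIntegral.integral_same, add_zero] at h0
    refine h0.congr' ?_
    filter_upwards [self_mem_nhdsWithin] with x hx
    simp only [hu]
    rw [mul_div_cancel_left₀ _ (ofReal_cpow_ne_zero hx (1 / 2 + m))]
  · have h0 : Tendsto w (𝓝[>] 0) (𝓝 (w 0)) :=
      (hwc 0 self_mem_Ici).mono_left (nhdsWithin_mono _ Ioi_subset_Ici_self)
    rw [hw 0 le_rfl] at h0
    simp only [volterraOp, intervalIntegral.integral_same, add_zero] at h0
    obtain ⟨M, hM⟩ := isCompact_Icc.exists_bound_of_continuousOn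
      (hwc.mono (Icc_subset_Ici_self (b := 0) (a := 1)))
    -- The factor s^{2 Re m} ≤ x^{2 Re m} can be pulled out of V, leaving a vanishing integral; so V
    -- does not contribute to the leading term of u'.
    have h1 : Tendsto (fun x : ℝ => (x : ℂ) ^ (-(2 * m)) * V x) (𝓝[>] 0) (𝓝 0) := by
      have h2 : Tendsto (fun x : ℝ => M * ∫ s in (0 : ℝ)..x, ‖(s : ℂ) * (Q s + k ^ 2)‖) (𝓝[>] 0)
          (𝓝 0) := by
        have := ((continuousOn_primitive_Ici fun b hb => (hi b hb).norm) 0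
          self_mem_Ici).mono_left (nhdsWithin_mono _ Ioi_subset_Ici_self)
        simpa using this.const_mul M
      refine squeeze_zero_norm' ?_ h2
      filter_upwards [Ioo_mem_nhdsGT one_pos] with x hx
      have hb : ‖V x‖ ≤ ∫ s in (0 : ℝ)..x, x ^ (2 * m.re) * M * ‖(s : ℂ) * (Q s + k ^ 2)‖ := by
        refine intervalIntegral.norm_integral_le_of_norm_le hx.1.le ?_
          ((hi x hx.1.le).norm.const_mul _)
        refine Eventually.of_forall fun s hs => ?_
        rw [norm_mul, norm_innerCoeff hs.1]
        have a1 := Real.rpow_le_rpow hs.1.le hs.2 (by positivity : 0 ≤ 2 * m.re)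
        have a2 := hM s ⟨hs.1.le, hs.2.trans hx.2.le⟩
        calc _ = s ^ (2 * m.re) * ‖w s‖ * ‖(s : ℂ) * (Q s + k ^ 2)‖ := by ring
          _ ≤ _ := mul_le_mul_of_nonneg_right (mul_le_mul a1 a2 (norm_nonneg _)
            (Real.rpow_nonneg hx.1.le _)) (norm_nonneg _)
      rw [intervalIntegral.integral_const_mul] at hb
      rw [norm_mul, Complex.norm_cpow_eq_rpow_re_of_pos hx.1]
      have hre : (-(2 * m)).re = -(2 * m.re) := by simp
      have hpos : 0 < x ^ (2 * m.re) := Real.rpow_pos_of_pos hx.1 _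
      rw [hre, Real.rpow_neg hx.1.le, inv_mul_le_iff₀ hpos]
      linarith
    have h3 := (h0.const_mul (1 / 2 + m)).add h1
    rw [add_zero] at h3
    refine h3.congr' ?_
    filter_upwards [self_mem_nhdsWithin] with x hx
    have hx : 0 < x := hx
    have hx0 : (x : ℂ) ≠ 0 := by exact_mod_cast hx.ne'
    rw [(hud x hx).deriv]
    have e1 : (x : ℂ) ^ (-1 / 2 - m) = (x : ℂ) ^ (-(2 * m)) * (x : ℂ) ^ (-1 / 2 + m) := by
      rw [← Complex.cpow_add _ _ hx0]; congr 1; ring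
    have e2 := ofReal_cpow_ne_zero hx (-1 / 2 + m)
    simp only [hu']
    rw [e1, eq_div_iff e2]
    ring

/-! ### Leading coefficients, the unperturbed solution and principal solutions -/

theorem norm_ofReal_cpow {x e : ℝ} (hx : 0 < x) {z : ℂ} (hz : z.re = e) :
    ‖(x : ℂ) ^ z‖ = x ^ e := by
  rw [Complex.norm_cpow_eq_rpow_re_of_pos hx, hz]

theorem neg_half_re : (-1 / 2 : ℂ).re = -1 / 2 := by
  have : (-1 / 2 : ℂ) = ((-1 / 2 : ℝ) : ℂ) := by push_cast; rfl
  rw [this, Complex.ofReal_re]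

/-- A complex power of x > 0 has modulus x^{Re z}, so error terms in real powers can be read as
limits of quotients by complex powers. -/
theorem isLittleO_rpow_iff {f : ℝ → ℂ} {z : ℂ} {e : ℝ} (hz : z.re = e) :
    (f =o[𝓝[>] 0] fun x : ℝ => x ^ e) ↔
      Tendsto (fun x : ℝ => f x / (x : ℂ) ^ z) (𝓝[>] 0) (𝓝 0) := by
  have h1 : (fun x : ℝ => ‖(x : ℂ) ^ z‖) =ᶠ[𝓝[>] 0] fun x : ℝ => x ^ e := by
    filter_upwards [self_mem_nhdsWithin] with x hx using norm_ofReal_cpow hx hz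
  rw [← isLittleO_congr (EventuallyEq.refl _ f) h1, isLittleO_norm_right,
    isLittleO_iff_tendsto']
  filter_upwards [self_mem_nhdsWithin] with x hx h0
  exact absurd h0 (ofReal_cpow_ne_zero hx z)

theorem isBigO_of_tendsto_div {f S : ℝ → ℂ} {ρ : ℝ → ℝ} {c : ℂ}
    (h : Tendsto (fun x => f x / S x) (𝓝[>] 0) (𝓝 c)) (h0 : ∀ᶠ x in 𝓝[>] 0, S x ≠ 0)
    (hS : ∀ᶠ x in 𝓝[>] 0, ‖S x‖ = ‖ρ x‖) : f =O[𝓝[>] 0] ρ := by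
  refine (isBigO_of_div_tendsto_nhds (h0.mono fun x hx h => absurd h hx) c h).trans ?_
  exact IsBigO.of_bound 1 (hS.mono fun x hx => by rw [hx, one_mul])

section Unperturbed

open Complex

theorem analyticOnNhd_regularizedHGFun (a : ℂ) :
    AnalyticOnNhd ℂ (regularizedHGFun 0 {a}) univ := by
  have hr : (regularizedHGFunSeries 0 {a}).radius = ⊤ :=
    radius_regularizedHGFunSeries_eq_top (by simp)
  have h := (regularizedHGFunSeries 0 {a}).hasFPowerSeriesOnBall (by rw [hr]; simp)
  rw [hr] at h
  intro z _
  exact h.analyticOnNhd z (by simp)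

theorem regularizedHGFun_zero (a : ℂ) : regularizedHGFun 0 {a} 0 = (Gamma a)⁻¹ := by
  have hr : (regularizedHGFunSeries 0 {a}).radius = ⊤ :=
    radius_regularizedHGFunSeries_eq_top (by simp)
  have h := (regularizedHGFunSeries 0 {a}).hasFPowerSeriesOnBall (by rw [hr]; simp)
  have := h.coeff_zero (fun _ => 0)
  rw [regularizedHGFun, ← this, regularizedHGFunSeries, FormalMultilinearSeries.ofScalars]
  simp [regularizedHGFunCoeff]

/-- The power x^{1/2+m} multiplies an entire function of x² with value 1/Γ(m+1) at 0;
differentiating that factor contributes only a relative O(x²) to the derivative. -/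
theorem hasLeadingCoeff_u0 (m k : ℂ) : HasLeadingCoeff m (Gamma (m + 1))⁻¹ (u0 m k) := by
  set F := regularizedHGFun 0 {m + 1} with hF
  have hFa : AnalyticOnNhd ℂ F univ := analyticOnNhd_regularizedHGFun (m + 1)
  have hz : Continuous fun x : ℝ => k ^ 2 * (x : ℂ) ^ 2 / 4 := by fun_prop
  have hlim : ∀ G : ℂ → ℂ, AnalyticOnNhd ℂ G univ →
      Tendsto (fun x : ℝ => G (k ^ 2 * (x : ℂ) ^ 2 / 4)) (𝓝[>] 0) (𝓝 (G 0)) := fun G hG => by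
    have h1 : Continuous G := continuousOn_univ.1 hG.continuousOn
    have h2 := ((h1.comp hz).tendsto 0).mono_left (nhdsWithin_le_nhds (s := Ioi 0))
    simpa [Function.comp_def] using h2
  have hF0 : F 0 = (Gamma (m + 1))⁻¹ := regularizedHGFun_zero (m + 1)
  have l1 := hlim F hFa
  have l2 := hlim (deriv F) hFa.deriv
  rw [hF0] at l1
  constructor
  · refine l1.congr' ?_
    filter_upwards [self_mem_nhdsWithin] with x hx
    rw [u0, mul_div_cancel_left₀ _ (ofReal_cpow_ne_zero hx _)]
  · have l3 : Tendsto (fun x : ℝ => (x : ℂ) ^ 2 * (k ^ 2 / 2)) (𝓝[>] 0) (𝓝 0) := by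
      have : Continuous fun x : ℝ => (x : ℂ) ^ 2 * (k ^ 2 / 2) := by fun_prop
      simpa using (this.tendsto 0).mono_left (nhdsWithin_le_nhds (s := Ioi 0))
    have l4 := (l1.const_mul (1 / 2 + m)).add (l3.mul l2)
    rw [zero_mul, add_zero] at l4
    refine l4.congr' ?_
    filter_upwards [self_mem_nhdsWithin] with x hx
    have hx : 0 < x := hx
    have hx0 : (x : ℂ) ≠ 0 := by exact_mod_cast hx.ne'
    have d1 : HasDerivAt (fun x : ℝ => k ^ 2 * (x : ℂ) ^ 2 / 4) (k ^ 2 * x / 2) x := by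
      refine (((((hasDerivAt_id (x : ℂ)).pow 2).const_mul (k ^ 2)).div_const 4).comp_ofReal
        ).congr_deriv ?_
      simp only [id]
      push_cast
      ring
    have d2 : HasDerivAt (fun x : ℝ => F (k ^ 2 * (x : ℂ) ^ 2 / 4))
        (deriv F (k ^ 2 * (x : ℂ) ^ 2 / 4) * (k ^ 2 * x / 2)) x :=
      HasDerivAt.comp x (hFa _ (mem_univ _)).differentiableAt.hasDerivAt d1
    have d3 := (hasDerivAt_cpow hx (1 / 2 + m)).mul d2
    have d4 : deriv (u0 m k) x = _ := d3.deriv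
    rw [d4]
    have e1 : (x : ℂ) ^ (1 / 2 + m - 1) = (x : ℂ) ^ (-1 / 2 + m) := by congr 1; ring
    have e2 : (x : ℂ) ^ (1 / 2 + m) = (x : ℂ) ^ (-1 / 2 + m) * x := by
      nth_rewrite 3 [← cpow_one (x : ℂ)]
      rw [← cpow_add _ _ hx0]; congr 1; ring
    rw [e1, e2, eq_div_iff (ofReal_cpow_ne_zero hx _)]
    ring

end Unperturbed

/-- The two error conditions say that u and u_m⁰ have the same leading coefficient. From here on
u_m⁰ enters only through the number 1/Γ(m+1). -/
theorem isPrincipal_iff {u : ℝ → ℂ} : IsPrincipal Q m k u ↔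
    IsEigensolution Q m k u ∧ HasLeadingCoeff m (Complex.Gamma (m + 1))⁻¹ u := by
  have h0 := hasLeadingCoeff_u0 m k
  have e1 : (1 / 2 + m).re = 1 / 2 + m.re := by simp
  have e2 : (-1 / 2 + m).re = -1 / 2 + m.re := by
    rw [Complex.add_re, neg_half_re]
  rw [IsPrincipal, isLittleO_rpow_iff e1, isLittleO_rpow_iff e2, HasLeadingCoeff]
  simp only [sub_div]
  refine and_congr_right fun _ => and_congr ?_ ?_
  · constructor
    · intro h; simpa using h.add h0.1
    · intro h; simpa using h.sub h0.1
  · constructor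
    · intro h; simpa using h.add h0.2
    · intro h; simpa using h.sub h0.2

/-! ### Asymptotics of arbitrary eigensolutions -/

/-- If `E' = o(ρ')` and `ρ → ∞` at `0`, then `E = o(ρ)`. -/
theorem isLittleO_of_deriv_isLittleO {E E' : ℝ → ℂ} {ρ ρ' : ℝ → ℝ}
    (hE : ∀ᶠ x in 𝓝[>] 0, HasDerivAt E (E' x) x) (hρ : ∀ᶠ x in 𝓝[>] 0, HasDerivAt ρ (-ρ' x) x)
    (hρ' : ∀ᶠ x in 𝓝[>] 0, 0 ≤ ρ' x) (ho : E' =o[𝓝[>] 0] ρ') (hlim : Tendsto ρ (𝓝[>] 0) atTop) :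
    E =o[𝓝[>] 0] ρ := by
  rw [isLittleO_iff]
  intro ε hε
  have hall := (hE.and hρ).and (hρ'.and (ho.def (half_pos hε)))
  obtain ⟨δ, hδ, H⟩ := mem_nhdsGT_iff_exists_Ioo_subset.1 hall
  have hδ : 0 < δ := hδ
  set x₀ := δ / 2
  -- The mean value inequality compares E with (ε/2)ρ between x and the fixed point x₀; the values
  -- at x₀ are later absorbed because ρ tends to infinity.
  have hmv : ∀ x ∈ Ioo 0 x₀, ‖E x₀ - E x‖ ≤ ε / 2 * (ρ x - ρ x₀) := by
    intro x hx
    have hmem : ∀ t ∈ Icc x x₀, t ∈ Ioo 0 δ := fun t ht =>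
      ⟨hx.1.trans_le ht.1, lt_of_le_of_lt ht.2 (half_lt_self hδ)⟩
    refine image_norm_le_of_norm_deriv_right_le_deriv_boundary'
      (f := fun t => E t - E x) (f' := E') (B := fun t => ε / 2 * (ρ x - ρ t))
      (B' := fun t => ε / 2 * ρ' t) ?_ ?_ (by simp) ?_ ?_ ?_ (right_mem_Icc.2 hx.2.le)
    · exact fun t ht => ((H (hmem t ht)).1.1.sub_const _).continuousAt.continuousWithinAt
    · exact fun t ht =>
        ((H (hmem t (Ico_subset_Icc_self ht))).1.1.sub_const _).hasDerivWithinAt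
    · exact fun t ht => (((H (hmem t ht)).1.2.const_sub _).const_mul
        _).continuousAt.continuousWithinAt
    · intro t ht
      refine ((((H (hmem t (Ico_subset_Icc_self ht))).1.2.const_sub (ρ x)).const_mul
        (ε / 2)).congr_deriv ?_).hasDerivWithinAt
      ring
    · intro t ht
      obtain ⟨_, h3, h4⟩ := H (hmem t (Ico_subset_Icc_self ht))
      rwa [Real.norm_of_nonneg h3] at h4
  filter_upwards [Ioo_mem_nhdsGT (half_pos hδ), hlim.eventually_ge_atTop 0,
    hlim.eventually_ge_atTop (2 / ε * (‖E x₀‖ + ε / 2 * |ρ x₀|))] with x hx h0 h1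
  rw [Real.norm_of_nonneg h0]
  have h2 := hmv x hx
  have h3 : ‖E x‖ ≤ ‖E x₀‖ + ‖E x₀ - E x‖ := by
    calc ‖E x‖ = ‖E x₀ - (E x₀ - E x)‖ := by congr 1; ring
      _ ≤ _ := norm_sub_le _ _
  have h4 : ‖E x₀‖ + ε / 2 * |ρ x₀| ≤ ε / 2 * ρ x := by
    have := mul_le_mul_of_nonneg_left h1 (half_pos hε).le
    calc _ = ε / 2 * (2 / ε * (‖E x₀‖ + ε / 2 * |ρ x₀|)) := by field_simp
      _ ≤ _ := this
  have h5 := mul_le_mul_of_nonneg_left (neg_abs_le (ρ x₀)) (half_pos hε).le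
  linarith

theorem HasLeadingCoeff.eventually_ne_zero {u : ℝ → ℂ} {c : ℂ} (h : HasLeadingCoeff m c u)
    (hc : c ≠ 0) : ∀ᶠ x in 𝓝[>] 0, u x ≠ 0 := by
  filter_upwards [h.1.eventually_ne hc] with x hx h0
  simp [h0] at hx

/-- Quotients of eigensolutions: `(g/u)' = -W/u²`. -/
theorem hasDerivAt_quotient {g u : ℝ → ℂ} (hg : IsEigensolution Q m k g)
    (hu : IsEigensolution Q m k u) {W : ℂ}
    (hW : ∀ x, 0 < x → g x * deriv u x - deriv g x * u x = W) {x : ℝ} (hx : 0 < x)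
    (hux : u x ≠ 0) : HasDerivAt (fun x => g x / u x) (-W / u x ^ 2) x := by
  refine ((hg.1.hasDerivAt hx).div (hu.1.hasDerivAt hx) hux).congr_deriv ?_
  rw [← hW x hx]
  ring

/-- Two eigensolutions with vanishing Wronskian are proportional. -/
theorem IsEigensolution.exists_eq_const_mul {g u : ℝ → ℂ} (hg : IsEigensolution Q m k g)
    (hu : IsEigensolution Q m k u) (hQ : LocallyIntegrableOn Q (Ioi 0))
    (hu0 : ∀ᶠ x in 𝓝[>] 0, u x ≠ 0)
    (hW : ∀ x, 0 < x → g x * deriv u x - deriv g x * u x = 0) :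
    ∃ C : ℂ, ∀ x, 0 < x → g x = C * u x := by
  obtain ⟨δ, hδ, H⟩ := mem_nhdsGT_iff_exists_Ioo_subset.1 hu0
  have hδ : 0 < δ := hδ
  have hd : ∀ x ∈ Ioo 0 δ, HasDerivAt (fun x => g x / u x) 0 x := fun x hx => by
    simpa using hasDerivAt_quotient hg hu hW hx.1 (H hx)
  obtain ⟨C, hC⟩ := isOpen_Ioo.exists_is_const_of_deriv_eq_zero isPreconnected_Ioo
    (fun x hx => (hd x hx).differentiableAt.differentiableWithinAt)
    (fun x hx => (hd x hx).deriv)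
  refine ⟨C, fun x hx => ?_⟩
  have := (hg.sub_const_mul hu C).eq_zero_of_eventually hQ (by
    filter_upwards [Ioo_mem_nhdsGT hδ] with y hy
    have := hC y hy
    rw [div_eq_iff (H hy)] at this
    rw [this, sub_self]) hx
  exact sub_eq_zero.1 this

/-- Asymptotics of an arbitrary eigensolution in terms of a comparison function `S` with
`S' = σ x^{-1-2m}` whose modulus tends to infinity. -/
theorem IsEigensolution.tendsto_div_comparison {g u S : ℝ → ℂ} {ρ : ℝ → ℝ} {c σ d W : ℂ} {τ : ℝ}
    (hg : IsEigensolution Q m k g) (hu : IsEigensolution Q m k u)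
    (hW : ∀ x, 0 < x → g x * deriv u x - deriv g x * u x = W)
    (hL : HasLeadingCoeff m c u) (hc : c ≠ 0) (hσ : σ ≠ 0) (hτ : 0 < τ)
    (hS : ∀ x : ℝ, 0 < x → HasDerivAt S (σ * (x : ℂ) ^ (-1 - 2 * m)) x)
    (hρ : ∀ x : ℝ, 0 < x → HasDerivAt ρ (-(τ * x ^ (-1 - 2 * m.re))) x)
    (hSρ : ∀ᶠ x in 𝓝[>] 0, ‖S x‖ = ρ x) (hlim : Tendsto ρ (𝓝[>] 0) atTop)
    (hd : Tendsto (fun x : ℝ => ((x : ℂ) ^ (2 * m) * S x)⁻¹) (𝓝[>] 0) (𝓝 d)) :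
    Tendsto (fun x : ℝ => g x / ((x : ℂ) ^ (1 / 2 + m) * S x)) (𝓝[>] 0) (𝓝 (-W / (c * σ))) ∧
    ∃ e, Tendsto (fun x : ℝ => deriv g x / ((x : ℂ) ^ (-1 / 2 + m) * S x)) (𝓝[>] 0) (𝓝 e) := by
  have hu0 := hL.eventually_ne_zero hc
  have hS0 : ∀ᶠ x in 𝓝[>] 0, S x ≠ 0 := by
    filter_upwards [hSρ, hlim.eventually_gt_atTop 0] with x h1 h2
    rw [← norm_pos_iff, h1]
    exact h2
  -- The constant is chosen so that α S' = -W c⁻² x^{-1-2m}, the leading term of (g/u)'.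
  set α : ℂ := -W / (c ^ 2 * σ) with hα
  set z : ℂ := -1 - 2 * m with hz
  have hzre : z.re = -1 - 2 * m.re := by simp [hz]
  have hsq : ∀ x : ℝ, 0 < x → ((x : ℂ) ^ (1 / 2 + m)) ^ 2 * (x : ℂ) ^ z = 1 := fun x hx => by
    have hx0 : (x : ℂ) ≠ 0 := by exact_mod_cast hx.ne'
    rw [← Complex.cpow_nat_mul, ← Complex.cpow_add _ _ hx0]
    convert Complex.cpow_zero (x : ℂ) using 2
    rw [hz]; push_cast; ring
  have ho : (fun x : ℝ => g x / u x - α * S x) =o[𝓝[>] 0] ρ := by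
    refine isLittleO_of_deriv_isLittleO
      (E' := fun x : ℝ => -W / u x ^ 2 - α * (σ * (x : ℂ) ^ z))
      (ρ' := fun x => τ * x ^ (-1 - 2 * m.re)) ?_ ?_ ?_ ?_ hlim
    · filter_upwards [self_mem_nhdsWithin, hu0] with x hx hux
      exact (hasDerivAt_quotient hg hu hW hx hux).sub ((hS x hx).const_mul α)
    · filter_upwards [self_mem_nhdsWithin] with x hx using hρ x hx
    · filter_upwards [self_mem_nhdsWithin] with x hx
      exact mul_nonneg hτ.le (Real.rpow_nonneg (le_of_lt hx) _)
    · refine IsLittleO.const_mul_right hτ.ne' ?_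
      rw [isLittleO_rpow_iff hzre]
      have h1 : Tendsto (fun x : ℝ => -W / (u x / (x : ℂ) ^ (1 / 2 + m)) ^ 2 - α * σ) (𝓝[>] 0)
          (𝓝 (-W / c ^ 2 - α * σ)) :=
        ((tendsto_const_nhds.div (hL.1.pow 2) (pow_ne_zero 2 hc)).sub tendsto_const_nhds)
      have h2 : -W / c ^ 2 - α * σ = 0 := by rw [hα]; field_simp; ring
      rw [h2] at h1
      refine h1.congr' ?_
      filter_upwards [self_mem_nhdsWithin, hu0] with x hx hux
      have hzx := ofReal_cpow_ne_zero hx z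
      have hs := hsq x hx
      rw [eq_div_iff hzx, div_pow, div_div_eq_mul_div]
      have : -W * ((x : ℂ) ^ (1 / 2 + m)) ^ 2 / u x ^ 2 * (x : ℂ) ^ z = -W / u x ^ 2 := by
        linear_combination -W / u x ^ 2 * hs
      rw [sub_mul, this, mul_assoc]
  have hR : Tendsto (fun x : ℝ => g x / u x / S x) (𝓝[>] 0) (𝓝 α) := by
    have h1 : (fun x : ℝ => g x / u x - α * S x) =o[𝓝[>] 0] S := by
      refine ho.trans_isBigO (IsBigO.of_bound 1 ?_)
      filter_upwards [hSρ] with x hx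
      rw [hx, one_mul, ← hx, norm_norm]
    have h2 := (h1.tendsto_div_nhds_zero).add_const α
    rw [zero_add] at h2
    refine h2.congr' ?_
    filter_upwards [hS0] with x hx
    rw [sub_div, mul_div_cancel_right₀ _ hx, sub_add_cancel]
  have hmain : Tendsto (fun x : ℝ => g x / ((x : ℂ) ^ (1 / 2 + m) * S x)) (𝓝[>] 0)
      (𝓝 (-W / (c * σ))) := by
    have h1 := hL.1.mul hR
    have h2 : c * α = -W / (c * σ) := by rw [hα]; field_simp
    rw [h2] at h1
    refine h1.congr' ?_
    filter_upwards [hu0] with x hux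
    rw [div_div, div_mul_div_comm, mul_left_comm, mul_div_mul_left _ _ hux]
  refine ⟨hmain, ?_⟩
  -- The Wronskian gives g' = (g u' - W) / u; divided by x^{-1/2+m} S, its second term is governed
  -- by the limit `d`.
  have h3 := ((hmain.mul hL.2).sub (hd.const_mul W)).div hL.1 hc
  refine ⟨_, h3.congr' ?_⟩
  filter_upwards [self_mem_nhdsWithin, hu0, hS0] with x hx hux hSx
  have hx : 0 < x := hx
  have hx0 : (x : ℂ) ≠ 0 := by exact_mod_cast hx.ne'
  have a1 := ofReal_cpow_ne_zero hx (1 / 2 + m)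
  have a2 := ofReal_cpow_ne_zero hx (-1 / 2 + m)
  have e1 : (x : ℂ) ^ (2 * m) = (x : ℂ) ^ (1 / 2 + m) * (x : ℂ) ^ (-1 / 2 + m) := by
    rw [← Complex.cpow_add _ _ hx0]; congr 1; ring
  have e2 := hW x hx
  simp only [Pi.div_apply]
  rw [e1]
  generalize (x : ℂ) ^ (1 / 2 + m) = X at *
  generalize (x : ℂ) ^ (-1 / 2 + m) = Y at *
  field_simp
  linear_combination e2

/-! ### Imaginary index: variation of constants -/

/-- The amplitude of `x^{1/2+m}` (up to the factor `2m`) obtained from `g` by variation of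
constants. -/
noncomputable def amplitude (m : ℂ) (g : ℝ → ℂ) (x : ℝ) : ℂ :=
  (m - 1 / 2) * ((x : ℂ) ^ (-1 / 2 - m) * g x) + (x : ℂ) ^ (1 / 2 - m) * deriv g x

/-- The equation involves m only through m², so estimates for one amplitude also serve the other. -/
theorem IsEigensolution.neg_index {g : ℝ → ℂ} (hg : IsEigensolution Q m k g) :
    IsEigensolution Q (-m) k g := by
  refine ⟨hg.1, ?_⟩
  filter_upwards [hg.2] with x hx
  rw [← hx, besselOp, besselOp, neg_sq]

theorem IsEigensolution.isAC_amplitude {g : ℝ → ℂ} (hg : IsEigensolution Q m k g) :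
    IsAC (amplitude m g) :=
  ((IsAC.const _).mul ((isAC_cpow _).mul hg.1.isAC)).add ((isAC_cpow _).mul hg.1.2)

/-- The amplitude is the Wronskian of x^{1/2-m} with g. As x^{1/2-m} solves the equation with Q + k²
removed, only the term (Q + k²) g survives in its derivative. -/
theorem IsEigensolution.integral_amplitude {g : ℝ → ℂ} (hg : IsEigensolution Q m k g)
    (hQ : LocallyIntegrableOn Q (Ioi 0)) {a b : ℝ} (ha : 0 < a) (hb : 0 < b) :
    ∫ x in a..b, (x : ℂ) ^ (1 / 2 - m) * ((Q x + k ^ 2) * g x) =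
      amplitude m g b - amplitude m g a := by
  refine (hg.isAC_amplitude a b ha hb).integral_eq_sub_of_ae_hasDerivAt ?_ ?_
  · filter_upwards [hg.ae_hasDerivAt] with x h hx
    have hx : 0 < x := uIcc_subset_Ioi ha hb hx
    have hx0 : (x : ℂ) ≠ 0 := by exact_mod_cast hx.ne'
    refine ((((hasDerivAt_cpow hx (-1 / 2 - m)).mul (hg.1.hasDerivAt hx)).const_mul
      (m - 1 / 2)).add ((hasDerivAt_cpow hx (1 / 2 - m)).mul (h hx))).congr_deriv ?_
    have e1 : (x : ℂ) ^ (1 / 2 - m) = (x : ℂ) ^ (-1 / 2 - m - 1) * x ^ 2 := by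
      rw [← Complex.cpow_natCast, ← Complex.cpow_add _ _ hx0]; congr 1; push_cast; ring
    have e2 : (x : ℂ) ^ (1 / 2 - m - 1) = (x : ℂ) ^ (-1 / 2 - m) := by congr 1; ring
    rw [e2, e1, schrodingerCoeff]
    field_simp
    ring
  · have h1 := (intervalIntegrable_of_locallyIntegrableOn hQ ha hb).add
      (intervalIntegrable_const (c := k ^ 2))
    have hsub := uIcc_subset_Ioi ha hb
    exact (h1.mul_continuousOn (hg.1.isAC.continuousOn.mono hsub)).continuousOn_mul
      ((continuousOn_cpow _).mono hsub)

/-- This is Cramer's rule for x^{1/2±m}, whose Wronskian has modulus 2|m|; it recovers g only if m ≠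
0. -/
theorem two_mul_eq_amplitude (g : ℝ → ℂ) {x : ℝ} (hx : 0 < x) :
    2 * m * g x = (x : ℂ) ^ (1 / 2 + m) * amplitude m g x -
      (x : ℂ) ^ (1 / 2 - m) * amplitude (-m) g x := by
  have hx0 : (x : ℂ) ≠ 0 := by exact_mod_cast hx.ne'
  have e1 : (x : ℂ) ^ (1 / 2 + m) * (x : ℂ) ^ (-1 / 2 - m) = 1 := by
    rw [← Complex.cpow_add _ _ hx0]; ring_nf; simp
  have e2 : (x : ℂ) ^ (1 / 2 - m) * (x : ℂ) ^ (-1 / 2 + m) = 1 := by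
    rw [← Complex.cpow_add _ _ hx0]; ring_nf; simp
  simp only [amplitude, sub_neg_eq_add]
  linear_combination -(m - 1 / 2) * g x * e1 + (-m - 1 / 2) * g x * e2

theorem two_mul_deriv_eq_amplitude (g : ℝ → ℂ) {x : ℝ} (hx : 0 < x) :
    2 * m * deriv g x = (m + 1 / 2) * ((x : ℂ) ^ (-1 / 2 + m) * amplitude m g x) +
      (m - 1 / 2) * ((x : ℂ) ^ (-1 / 2 - m) * amplitude (-m) g x) := by
  have hx0 : (x : ℂ) ≠ 0 := by exact_mod_cast hx.ne'
  have e1 : (x : ℂ) ^ (-1 / 2 + m) * (x : ℂ) ^ (1 / 2 - m) = 1 := by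
    rw [← Complex.cpow_add _ _ hx0]; ring_nf; simp
  have e2 : (x : ℂ) ^ (-1 / 2 - m) * (x : ℂ) ^ (1 / 2 + m) = 1 := by
    rw [← Complex.cpow_add _ _ hx0]; ring_nf; simp
  simp only [amplitude, sub_neg_eq_add]
  linear_combination -(m + 1 / 2) * deriv g x * e1 - (m - 1 / 2) * deriv g x * e2

/-- Both amplitudes of an eigensolution stay bounded at `0` for imaginary index. -/
theorem IsEigensolution.exists_amplitude_le {g : ℝ → ℂ} (hg : IsEigensolution Q m k g)
    (hm : m.re = 0) (hm0 : m ≠ 0) (hQ : LocallyIntegrableOn Q (Ioi 0))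
    (hi : ∀ b, 0 ≤ b → IntervalIntegrable (fun x : ℝ => (x : ℂ) * (Q x + k ^ 2)) volume 0 b) :
    ∃ C, ∀ᶠ x in 𝓝[>] (0 : ℝ), ‖amplitude m g x‖ + ‖amplitude (-m) g x‖ ≤ C := by
  set h : ℝ → ℝ := fun x => ‖amplitude m g x‖ + ‖amplitude (-m) g x‖ with hh
  have hmn : 0 < ‖m‖ := norm_pos_iff.2 hm0
  have hgn := hg.neg_index
  have hhc : ContinuousOn h (Ioi 0) :=
    hg.isAC_amplitude.continuousOn.norm.add hgn.isAC_amplitude.continuousOn.norm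
  have hgle : ∀ x, 0 < x → ‖g x‖ ≤ x ^ (1 / 2 : ℝ) * h x / (2 * ‖m‖) := fun x hx => by
    rw [le_div_iff₀ (by positivity)]
    have := congrArg norm (two_mul_eq_amplitude (m := m) g hx)
    rw [norm_mul, norm_mul, Complex.norm_ofNat] at this
    calc ‖g x‖ * (2 * ‖m‖) = 2 * ‖m‖ * ‖g x‖ := by ring
      _ ≤ _ := by
        rw [this]
        refine (norm_sub_le _ _).trans ?_
        rw [norm_mul, norm_mul, norm_ofReal_cpow (e := 1 / 2) hx (by simp [hm]),
          norm_ofReal_cpow (e := 1 / 2) hx (by simp [hm]), hh]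
        exact (mul_add _ _ _).symm.le
  -- With this bound each amplitude changes by at most M/4 on [x, b], where M bounds the sum of both
  -- moduli there; the two changes together cost M/2.
  have hsmall : ∃ b, 0 < b ∧ (∫ s in (0 : ℝ)..b, ‖(s : ℂ) * (Q s + k ^ 2)‖) ≤ ‖m‖ / 2 := by
    have := ((continuousOn_primitive_Ici fun b hb => (hi b hb).norm) 0
      self_mem_Ici).mono_left (nhdsWithin_mono _ Ioi_subset_Ici_self)
    simp only [intervalIntegral.integral_same] at this
    obtain ⟨b, h1, h2⟩ := ((this.eventually_le_const (half_pos hmn)).and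
      self_mem_nhdsWithin).exists
    exact ⟨b, h2, h1⟩
  obtain ⟨b, hb, hbs⟩ := hsmall
  have step : ∀ (n : ℂ) (_ : n.re = 0) (_ : IsEigensolution Q n k g) (M x y : ℝ), 0 < x → x ≤ y →
      y ≤ b → (∀ s ∈ Icc x b, h s ≤ M) → ‖amplitude n g y‖ ≤ ‖amplitude n g b‖ + M / 4 := by
    intro n hn hgn M x y hx hxy hyb hM
    have hy : 0 < y := hx.trans_le hxy
    have hM0 : 0 ≤ M := (by positivity : (0 : ℝ) ≤ h b).trans (hM b ⟨hxy.trans hyb, le_rfl⟩)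
    have h1 := hgn.integral_amplitude hQ hy hb
    have hii : IntervalIntegrable (fun s : ℝ => ‖(s : ℂ) * (Q s + k ^ 2)‖) volume y b :=
      ((hi b hb.le).norm).mono_set
        (uIcc_subset_uIcc (mem_uIcc_of_le hy.le hyb) right_mem_uIcc)
    have h2 : ‖∫ s in y..b, (s : ℂ) ^ (1 / 2 - n) * ((Q s + k ^ 2) * g s)‖ ≤
        ∫ s in y..b, M / (2 * ‖m‖) * ‖(s : ℂ) * (Q s + k ^ 2)‖ := by
      refine intervalIntegral.norm_integral_le_of_norm_le hyb ?_ (hii.const_mul _)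
      refine Eventually.of_forall fun s hs => ?_
      have hs0 : 0 < s := hy.trans hs.1
      rw [norm_mul, norm_mul, norm_mul, norm_ofReal_cpow (e := 1 / 2) hs0 (by simp [hn]),
        Complex.norm_real, Real.norm_of_nonneg hs0.le]
      have hss : s ^ (1 / 2 : ℝ) * s ^ (1 / 2 : ℝ) = s := by
        rw [← Real.rpow_add hs0]; norm_num
      have hp : 0 ≤ s ^ (1 / 2 : ℝ) := Real.rpow_nonneg hs0.le _
      calc s ^ (1 / 2 : ℝ) * (‖Q s + k ^ 2‖ * ‖g s‖)
          ≤ s ^ (1 / 2 : ℝ) * (‖Q s + k ^ 2‖ * (s ^ (1 / 2 : ℝ) * M / (2 * ‖m‖))) := by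
            gcongr
            refine (hgle s hs0).trans ?_
            gcongr
            exact hM s ⟨hxy.trans hs.1.le, hs.2⟩
        _ = (s ^ (1 / 2 : ℝ) * s ^ (1 / 2 : ℝ)) * M / (2 * ‖m‖) * ‖Q s + k ^ 2‖ := by ring
        _ = _ := by rw [hss]; ring
    rw [intervalIntegral.integral_const_mul] at h2
    have h3 : ∫ s in y..b, ‖(s : ℂ) * (Q s + k ^ 2)‖ ≤ ‖m‖ / 2 := by
      refine le_trans ?_ hbs
      refine intervalIntegral.integral_mono_interval hy.le hyb le_rfl ?_ (hi b hb.le).norm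
      exact Eventually.of_forall fun _ => norm_nonneg _
    have h4 : M / (2 * ‖m‖) * ∫ s in y..b, ‖(s : ℂ) * (Q s + k ^ 2)‖ ≤ M / 4 := by
      refine (mul_le_mul_of_nonneg_left h3 (by positivity)).trans (le_of_eq ?_)
      field_simp
      norm_num
    rw [h1] at h2
    have h5 : ‖amplitude n g y‖ ≤ ‖amplitude n g b‖ + ‖amplitude n g b - amplitude n g y‖ := by
      calc _ = ‖amplitude n g b - (amplitude n g b - amplitude n g y)‖ := by congr 1; ring
        _ ≤ _ := norm_sub_le _ _
    linarith
  refine ⟨2 * h b, ?_⟩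
  filter_upwards [Ioo_mem_nhdsGT hb] with x hx
  -- At a maximum point z of h on [x, b] the two estimates give h(z) ≤ h(b) + h(z)/2, hence the
  -- bound 2 h(b), which is independent of x.
  obtain ⟨z, hz, hmax⟩ := isCompact_Icc.exists_isMaxOn (nonempty_Icc.2 hx.2.le)
    (hhc.mono fun y hy => hx.1.trans_le hy.1)
  have hM : ∀ s ∈ Icc x b, h s ≤ h z := fun s hs => hmax hs
  have s1 := step m hm hg (h z) x z hx.1 hz.1 hz.2 hM
  have s2 := step (-m) (by simp [hm]) hgn (h z) x z hx.1 hz.1 hz.2 hM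
  have s3 : h z ≤ h b + h z / 2 := by
    simp only [hh] at s1 s2 ⊢
    linarith
  have s4 : h x ≤ h z := hM x ⟨le_rfl, hx.2.le⟩
  change h x ≤ 2 * h b
  linarith

theorem IsEigensolution.isBigO_of_re_eq_zero {g : ℝ → ℂ} (hg : IsEigensolution Q m k g)
    (hm : m.re = 0) (hm0 : m ≠ 0) (hQ : LocallyIntegrableOn Q (Ioi 0))
    (hi : ∀ b, 0 ≤ b → IntervalIntegrable (fun x : ℝ => (x : ℂ) * (Q x + k ^ 2)) volume 0 b) :
    g =O[𝓝[>] 0] (fun x : ℝ => x ^ (1 / 2 : ℝ)) ∧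
      deriv g =O[𝓝[>] 0] (fun x : ℝ => x ^ (-1 / 2 : ℝ)) := by
  obtain ⟨C, hC⟩ := hg.exists_amplitude_le hm hm0 hQ hi
  have hmn : 0 < ‖m‖ := norm_pos_iff.2 hm0
  constructor
  · refine IsBigO.of_bound (C / (2 * ‖m‖)) ?_
    filter_upwards [hC, self_mem_nhdsWithin] with x hx hx0
    have hx0 : 0 < x := hx0
    have := congrArg norm (two_mul_eq_amplitude (m := m) g hx0)
    rw [norm_mul, norm_mul, Complex.norm_ofNat] at this
    have hp : 0 ≤ x ^ (1 / 2 : ℝ) := Real.rpow_nonneg hx0.le _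
    rw [Real.norm_of_nonneg hp, div_mul_eq_mul_div, le_div_iff₀ (by positivity), mul_comm, this]
    refine (norm_sub_le _ _).trans ?_
    rw [norm_mul, norm_mul, norm_ofReal_cpow (e := 1 / 2) hx0 (by simp [hm]),
      norm_ofReal_cpow (e := 1 / 2) hx0 (by simp [hm])]
    nlinarith
  · refine IsBigO.of_bound ((‖m‖ + 1 / 2) * C / (2 * ‖m‖)) ?_
    filter_upwards [hC, self_mem_nhdsWithin] with x hx hx0
    have hx0 : 0 < x := hx0
    have := congrArg norm (two_mul_deriv_eq_amplitude (m := m) g hx0)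
    rw [norm_mul, norm_mul, Complex.norm_ofNat] at this
    have hp : 0 ≤ x ^ (-1 / 2 : ℝ) := Real.rpow_nonneg hx0.le _
    rw [Real.norm_of_nonneg hp, div_mul_eq_mul_div, le_div_iff₀ (by positivity), mul_comm, this]
    refine (norm_add_le _ _).trans ?_
    rw [norm_mul, norm_mul, norm_mul, norm_mul,
      norm_ofReal_cpow (e := -1 / 2) hx0 (by rw [Complex.add_re, neg_half_re, hm, add_zero]),
      norm_ofReal_cpow (e := -1 / 2) hx0 (by rw [Complex.sub_re, neg_half_re, hm, sub_zero])]
    have b1 : ‖m + 1 / 2‖ ≤ ‖m‖ + 1 / 2 := (norm_add_le _ _).trans (by simp)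
    have b2 : ‖m - 1 / 2‖ ≤ ‖m‖ + 1 / 2 := (norm_sub_le _ _).trans (by simp)
    calc _ ≤ (‖m‖ + 1 / 2) * (x ^ (-1 / 2 : ℝ) * ‖amplitude m g x‖) +
          (‖m‖ + 1 / 2) * (x ^ (-1 / 2 : ℝ) * ‖amplitude (-m) g x‖) := by gcongr
      _ = (‖m‖ + 1 / 2) * x ^ (-1 / 2 : ℝ) *
          (‖amplitude m g x‖ + ‖amplitude (-m) g x‖) := by ring
      _ ≤ (‖m‖ + 1 / 2) * x ^ (-1 / 2 : ℝ) * C := by gcongr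
      _ = _ := by ring

/-! ### The potential classes, uniqueness, and the cases Re m > 0 and m = 0 -/

theorem InL0.intervalIntegrable (hQ : InL0 Q) (k : ℂ) (b : ℝ) (hb : 0 ≤ b) :
    IntervalIntegrable (fun x : ℝ => (x : ℂ) * (Q x + k)) volume 0 b :=
  intervalIntegrable_weight_mul (ℓ := fun x => x) (κ := fun x => x) continuous_id hQ.1 hQ.2
    (fun _ hx => (abs_of_pos hx.1).le) k b hb

theorem InL0Log.intervalIntegrable (hQ : InL0Log Q) (k : ℂ) (b : ℝ) (hb : 0 ≤ b) :
    IntervalIntegrable (fun x : ℝ => (x : ℂ) * (Q x + k)) volume 0 b :=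
  intervalIntegrable_weight_mul (ℓ := fun x => x) (κ := fun x => x * (1 + |Real.log x|))
    continuous_id hQ.1 hQ.2
    (fun x hx => by
      rw [abs_of_pos hx.1]
      nlinarith [mul_nonneg hx.1.le (abs_nonneg (Real.log x))]) k b hb

theorem InL0Log.intervalIntegrable_log (hQ : InL0Log Q) (k : ℂ) (b : ℝ) (hb : 0 ≤ b) :
    IntervalIntegrable (fun x : ℝ => ((x * Real.log x : ℝ) : ℂ) * (Q x + k)) volume 0 b :=
  intervalIntegrable_weight_mul (ℓ := fun x => x * Real.log x)
    (κ := fun x => x * (1 + |Real.log x|)) Real.continuous_mul_log hQ.1 hQ.2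
    (fun x hx => by
      rw [abs_mul, abs_of_pos hx.1]
      nlinarith [hx.1]) k b hb

/-- An eigensolution is determined by its leading coefficient at `0`. -/
theorem eqOn_of_hasLeadingCoeff (hm : 0 ≤ m.re) (hQ : LocallyIntegrableOn Q (Ioi 0))
    {u v : ℝ → ℂ} {c : ℂ} (hc : c ≠ 0) (hu : IsEigensolution Q m k u)
    (hv : IsEigensolution Q m k v) (hLu : HasLeadingCoeff m c u) (hLv : HasLeadingCoeff m c v) :
    EqOn v u (Ioi 0) := by
  set d : ℝ → ℂ := fun x => v x - 1 * u x with hd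
  have hde : IsEigensolution Q m k d := hv.sub_const_mul hu 1
  have hd1 : Tendsto (fun x : ℝ => d x / (x : ℂ) ^ (1 / 2 + m)) (𝓝[>] 0) (𝓝 0) := by
    simpa [hd, sub_div] using hLv.1.sub hLu.1
  have hd2 : Tendsto (fun x : ℝ => deriv d x / (x : ℂ) ^ (-1 / 2 + m)) (𝓝[>] 0) (𝓝 0) := by
    have := hLv.2.sub hLu.2
    rw [sub_self] at this
    refine this.congr' ?_
    filter_upwards [self_mem_nhdsWithin] with x hx
    have : deriv d x = deriv v x - 1 * deriv u x :=
      ((hv.1.hasDerivAt hx).sub ((hu.1.hasDerivAt hx).const_mul 1)).deriv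
    rw [this, one_mul, sub_div]
  obtain ⟨W, hW⟩ := hde.exists_wronskian_eq hu
  -- The Wronskian is x^{2m} times a quantity tending to 0, and |x^{2m}| ≤ 1 on ]0, 1[.
  have hW0 : W = 0 := by
    have h1 := (hd1.mul hLu.2).sub (hd2.mul hLu.1)
    simp only [zero_mul, sub_zero] at h1
    have h2 : Tendsto (fun _ : ℝ => W) (𝓝[>] 0) (𝓝 0) := by
      rw [tendsto_zero_iff_norm_tendsto_zero]
      refine squeeze_zero' (Eventually.of_forall fun _ => norm_nonneg _) ?_
        (tendsto_zero_iff_norm_tendsto_zero.1 h1)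
      filter_upwards [Ioo_mem_nhdsGT one_pos] with x hx
      have hx0 : (x : ℂ) ≠ 0 := by exact_mod_cast hx.1.ne'
      have a1 := ofReal_cpow_ne_zero hx.1 (1 / 2 + m)
      have a2 := ofReal_cpow_ne_zero hx.1 (-1 / 2 + m)
      have e1 : (x : ℂ) ^ (2 * m) = (x : ℂ) ^ (1 / 2 + m) * (x : ℂ) ^ (-1 / 2 + m) := by
        rw [← Complex.cpow_add _ _ hx0]; congr 1; ring
      have e2 : W = (x : ℂ) ^ (2 * m) * (d x / (x : ℂ) ^ (1 / 2 + m) *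
          (deriv u x / (x : ℂ) ^ (-1 / 2 + m)) - deriv d x / (x : ℂ) ^ (-1 / 2 + m) *
          (u x / (x : ℂ) ^ (1 / 2 + m))) := by
        rw [e1, ← hW x hx.1]
        generalize (x : ℂ) ^ (1 / 2 + m) = X at *
        generalize (x : ℂ) ^ (-1 / 2 + m) = Y at *
        field_simp
      have e3 : ‖(x : ℂ) ^ (2 * m)‖ ≤ 1 := by
        rw [norm_ofReal_cpow (e := 2 * m.re) hx.1 (by simp)]
        exact Real.rpow_le_one hx.1.le hx.2.le (by positivity)
      calc ‖W‖ = _ := congrArg norm e2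
        _ ≤ _ := by
          rw [norm_mul]
          exact mul_le_of_le_one_left (norm_nonneg _) e3
    exact tendsto_nhds_unique tendsto_const_nhds h2
  subst hW0
  obtain ⟨C, hC⟩ := hde.exists_eq_const_mul hu hQ (hLu.eventually_ne_zero hc) hW
  have hC0 : C = 0 := by
    have h1 := hLu.1.const_mul C
    have h2 : Tendsto (fun x : ℝ => d x / (x : ℂ) ^ (1 / 2 + m)) (𝓝[>] 0) (𝓝 (C * c)) := by
      refine h1.congr' ?_
      filter_upwards [self_mem_nhdsWithin] with x hx
      rw [hC x hx, mul_div_assoc]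
    exact (mul_eq_zero.1 (tendsto_nhds_unique h2 hd1)).resolve_right hc
  intro x hx
  have := hC x hx
  simp only [hd, hC0, zero_mul, one_mul] at this
  exact sub_eq_zero.1 this

theorem wronskian_ne_zero_of_independent (hQ : LocallyIntegrableOn Q (Ioi 0)) {g u : ℝ → ℂ}
    {c W : ℂ} (hc : c ≠ 0) (hg : IsEigensolution Q m k g) (hu : IsEigensolution Q m k u)
    (hLu : HasLeadingCoeff m c u) (hind : IndependentOnHalfLine g u)
    (hW : ∀ x, 0 < x → g x * deriv u x - deriv g x * u x = W) : W ≠ 0 := by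
  rintro rfl
  obtain ⟨C, hC⟩ := hg.exists_eq_const_mul hu hQ (hLu.eventually_ne_zero hc) hW
  have h := LinearIndependent.pair_iff.1 hind 1 (-C) (by
    funext x
    have := hC x.1 x.2
    simp [this])
  exact one_ne_zero h.1

/-- The comparison function is S = x^{-2m}, with σ = -2m, so that x^{1/2+m} S = x^{1/2-m}. -/
theorem IsEigensolution.tendsto_of_re_pos {g u : ℝ → ℂ} {c W : ℂ} (hm : 0 < m.re)
    (hg : IsEigensolution Q m k g) (hu : IsEigensolution Q m k u)
    (hW : ∀ x, 0 < x → g x * deriv u x - deriv g x * u x = W)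
    (hL : HasLeadingCoeff m c u) (hc : c ≠ 0) :
    Tendsto (fun x : ℝ => g x / (x : ℂ) ^ (1 / 2 - m)) (𝓝[>] 0) (𝓝 (W / (c * (2 * m)))) ∧
    ∃ e, Tendsto (fun x : ℝ => deriv g x / (x : ℂ) ^ (-1 / 2 - m)) (𝓝[>] 0) (𝓝 e) := by
  have hm0 : m ≠ 0 := by rintro rfl; simp at hm
  have hσ : -(2 * m) ≠ 0 := neg_ne_zero.2 (mul_ne_zero two_ne_zero hm0)
  have e : ∀ a : ℂ, ∀ x : ℝ, 0 < x →
      (x : ℂ) ^ (a + m) * (x : ℂ) ^ (-(2 * m)) = (x : ℂ) ^ (a - m) := fun a x hx => by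
    rw [← Complex.cpow_add _ _ (by exact_mod_cast hx.ne')]; congr 1; ring
  have hS : ∀ x : ℝ, 0 < x → HasDerivAt (fun x : ℝ => (x : ℂ) ^ (-(2 * m)))
      (-(2 * m) * (x : ℂ) ^ (-1 - 2 * m)) x := fun x hx => by
    refine (hasDerivAt_cpow hx (-(2 * m))).congr_deriv ?_
    congr 2; ring
  have hρ : ∀ x : ℝ, 0 < x → HasDerivAt (fun x : ℝ => x ^ (-(2 * m.re)))
      (-(2 * m.re * x ^ (-1 - 2 * m.re))) x := fun x hx => by
    refine (Real.hasDerivAt_rpow_const (p := -(2 * m.re)) (Or.inl hx.ne')).congr_deriv ?_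
    rw [show -(2 * m.re) - 1 = -1 - 2 * m.re by ring]
    ring
  have hSρ : ∀ᶠ x : ℝ in 𝓝[>] 0, ‖(x : ℂ) ^ (-(2 * m))‖ = x ^ (-(2 * m.re)) := by
    filter_upwards [self_mem_nhdsWithin] with x hx
    exact norm_ofReal_cpow hx (by simp)
  have hd : Tendsto (fun x : ℝ => ((x : ℂ) ^ (2 * m) * (x : ℂ) ^ (-(2 * m)))⁻¹) (𝓝[>] 0)
      (𝓝 1) := by
    refine tendsto_const_nhds.congr' ?_
    filter_upwards [self_mem_nhdsWithin] with x hx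
    have hx : 0 < x := hx
    rw [← Complex.cpow_add _ _ (by exact_mod_cast hx.ne')]
    simp
  obtain ⟨h1, b, h2⟩ := hg.tendsto_div_comparison hu hW hL hc hσ
    (by positivity : 0 < 2 * m.re) hS hρ hSρ (tendsto_rpow_neg_nhdsGT_zero (by linarith)) hd
  constructor
  · rw [mul_neg, neg_div_neg_eq] at h1
    refine h1.congr' ?_
    filter_upwards [self_mem_nhdsWithin] with x hx
    rw [e _ x hx]
  · refine ⟨b, h2.congr' ?_⟩
    filter_upwards [self_mem_nhdsWithin] with x hx
    rw [e _ x hx]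

/-- The comparison function is S = ln x, with ρ = -ln x its modulus near 0. As 1/ln x tends to 0,
the Wronskian term drops out of the limit of g'. -/
theorem IsEigensolution.tendsto_of_index_zero {g u : ℝ → ℂ} {c W : ℂ}
    (hg : IsEigensolution Q 0 k g) (hu : IsEigensolution Q 0 k u)
    (hW : ∀ x, 0 < x → g x * deriv u x - deriv g x * u x = W)
    (hL : HasLeadingCoeff 0 c u) (hc : c ≠ 0) :
    Tendsto (fun x : ℝ => g x / ((x ^ (1 / 2 : ℝ) * Real.log x : ℝ) : ℂ)) (𝓝[>] 0)
      (𝓝 (-W / c)) ∧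
    ∃ e, Tendsto (fun x : ℝ => deriv g x / ((x ^ (-1 / 2 : ℝ) * Real.log x : ℝ) : ℂ)) (𝓝[>] 0)
      (𝓝 e) := by
  have hlog : Tendsto (fun x : ℝ => -Real.log x) (𝓝[>] 0) atTop :=
    tendsto_neg_atBot_atTop.comp Real.tendsto_log_nhdsGT_zero
  have hS : ∀ x : ℝ, 0 < x → HasDerivAt (fun x : ℝ => (Real.log x : ℂ))
      (1 * (x : ℂ) ^ (-1 - 2 * (0 : ℂ))) x := fun x hx => by
    refine (Real.hasDerivAt_log hx.ne').ofReal_comp.congr_deriv ?_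
    simp [Complex.cpow_neg_one]
  have hρ : ∀ x : ℝ, 0 < x → HasDerivAt (fun x : ℝ => -Real.log x)
      (-(1 * x ^ (-1 - 2 * (0 : ℂ).re))) x := fun x hx => by
    refine (Real.hasDerivAt_log hx.ne').neg.congr_deriv ?_
    simp [Real.rpow_neg_one]
  have hSρ : ∀ᶠ x : ℝ in 𝓝[>] 0, ‖(Real.log x : ℂ)‖ = -Real.log x := by
    filter_upwards [hlog.eventually_ge_atTop 0] with x hx
    rw [Complex.norm_real, Real.norm_eq_abs, abs_of_nonpos (by linarith)]
  have hd : Tendsto (fun x : ℝ => ((x : ℂ) ^ (2 * (0 : ℂ)) * (Real.log x : ℂ))⁻¹) (𝓝[>] 0)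
      (𝓝 0) := by
    have h3 : Tendsto (fun x : ℝ => (-(-Real.log x))⁻¹) (𝓝[>] 0) (𝓝 0) := by
      simpa [Function.comp_def, inv_neg] using (tendsto_inv_atTop_zero.comp hlog).neg
    have h4 := (Complex.continuous_ofReal.tendsto 0).comp h3
    simpa [Function.comp_def] using h4
  obtain ⟨h1, b, h2⟩ := hg.tendsto_div_comparison hu hW hL hc one_ne_zero one_pos hS hρ hSρ
    hlog hd
  constructor
  · rw [mul_one] at h1
    refine h1.congr' ?_
    filter_upwards [self_mem_nhdsWithin] with x hx
    rw [Complex.ofReal_mul, Complex.ofReal_cpow (le_of_lt hx)]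
    simp
  · refine ⟨b, h2.congr' ?_⟩
    filter_upwards [self_mem_nhdsWithin] with x hx
    rw [Complex.ofReal_mul, Complex.ofReal_cpow (le_of_lt hx)]
    simp

theorem gamma_inv_ne_zero (hm : 0 ≤ m.re) : (Complex.Gamma (m + 1))⁻¹ ≠ 0 :=
  inv_ne_zero (Complex.Gamma_ne_zero_of_re_pos (by simp; linarith))

end PerturbedBessel

open PerturbedBessel in
theorem mainTheorem3 (Q : ℝ → ℂ) (k : ℂ) (hk : 0 ≤ k.re) :
    -- (i) the case `Re m ≥ 0`, `m ≠ 0`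
    (∀ m : ℂ, 0 ≤ m.re → m ≠ 0 → PerturbedBessel.InL0 Q →
      (∀ g : ℝ → ℂ, PerturbedBessel.IsEigensolution Q m k g →
        g =O[𝓝[>] 0] (fun x : ℝ => x ^ (1 / 2 - m.re)) ∧
        deriv g =O[𝓝[>] 0] (fun x : ℝ => x ^ (-1 / 2 - m.re))) ∧
      (0 < m.re →
        -- `u` is `u_m(·,k)`, which exists and is unique
        ∃ u : ℝ → ℂ, PerturbedBessel.IsPrincipal Q m k u ∧
          (∀ v : ℝ → ℂ, PerturbedBessel.IsPrincipal Q m k v → EqOn v u (Ioi 0)) ∧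
          ∀ g : ℝ → ℂ, PerturbedBessel.IsEigensolution Q m k g →
            PerturbedBessel.IndependentOnHalfLine g u →
            ∃ c : ℂ, c ≠ 0 ∧
              Tendsto (fun x : ℝ => g x / (x : ℂ) ^ (1 / 2 - m)) (𝓝[>] 0) (𝓝 c))) ∧
    -- (ii) the case `m = 0`
    (PerturbedBessel.InL0Log Q →
      (∀ g : ℝ → ℂ, PerturbedBessel.IsEigensolution Q 0 k g →
        g =O[𝓝[>] 0] (fun x : ℝ => x ^ (1 / 2 : ℝ) * Real.log x) ∧
        deriv g =O[𝓝[>] 0] (fun x : ℝ => x ^ (-1 / 2 : ℝ) * Real.log x)) ∧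
      ∃ u : ℝ → ℂ, PerturbedBessel.IsPrincipal Q 0 k u ∧
        (∀ v : ℝ → ℂ, PerturbedBessel.IsPrincipal Q 0 k v → EqOn v u (Ioi 0)) ∧
        ∀ g : ℝ → ℂ, PerturbedBessel.IsEigensolution Q 0 k g →
          PerturbedBessel.IndependentOnHalfLine g u →
          ∃ c : ℂ, c ≠ 0 ∧
            Tendsto (fun x : ℝ => g x / ((x ^ (1 / 2 : ℝ) * Real.log x : ℝ) : ℂ))
              (𝓝[>] 0) (𝓝 c)) := by
  constructor
  · intro m hm hm0 hQ
    have hi := hQ.intervalIntegrable (k ^ 2)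
    have hc := gamma_inv_ne_zero hm
    rcases hm.eq_or_lt with hre | hpos
    · refine ⟨fun g hg => ?_, fun h => absurd hre h.ne⟩
      rw [← hre, sub_zero, sub_zero]
      exact hg.isBigO_of_re_eq_zero hre.symm hm0 hQ.1 hi
    · obtain ⟨u, hu, hL⟩ := exists_eigensolution_hasLeadingCoeff hm hi
        (volterraPair_of_re_pos hpos hi) (Complex.Gamma (m + 1))⁻¹
      refine ⟨fun g hg => ?_, fun _ => ⟨u, isPrincipal_iff.2 ⟨hu, hL⟩, fun v hv => ?_,
        fun g hg hind => ?_⟩⟩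
      · obtain ⟨W, hW⟩ := hg.exists_wronskian_eq hu
        obtain ⟨h1, e, h2⟩ := hg.tendsto_of_re_pos hpos hu hW hL hc
        constructor
        · refine isBigO_of_tendsto_div h1 ?_ ?_
          · filter_upwards [self_mem_nhdsWithin] with x hx using ofReal_cpow_ne_zero hx _
          · filter_upwards [self_mem_nhdsWithin] with x hx
            rw [Real.norm_of_nonneg (Real.rpow_nonneg (le_of_lt hx) _)]
            exact norm_ofReal_cpow hx (by simp)
        · refine isBigO_of_tendsto_div h2 ?_ ?_
          · filter_upwards [self_mem_nhdsWithin] with x hx using ofReal_cpow_ne_zero hx _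
          · filter_upwards [self_mem_nhdsWithin] with x hx
            rw [Real.norm_of_nonneg (Real.rpow_nonneg (le_of_lt hx) _)]
            exact norm_ofReal_cpow hx (by rw [Complex.sub_re, neg_half_re])
      · obtain ⟨hv, hLv⟩ := isPrincipal_iff.1 hv
        exact eqOn_of_hasLeadingCoeff hm hQ.1 hc hu hv hL hLv
      · obtain ⟨W, hW⟩ := hg.exists_wronskian_eq hu
        have hW0 := wronskian_ne_zero_of_independent hQ.1 hc hg hu hL hind hW
        exact ⟨_, div_ne_zero hW0 (mul_ne_zero hc (mul_ne_zero two_ne_zero hm0)),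
          (hg.tendsto_of_re_pos hpos hu hW hL hc).1⟩
  · intro hQ
    have hi := hQ.intervalIntegrable (k ^ 2)
    have hc := gamma_inv_ne_zero (m := 0) le_rfl
    obtain ⟨u, hu, hL⟩ := exists_eigensolution_hasLeadingCoeff (m := 0) le_rfl hi
      (volterraPair_zero hi (hQ.intervalIntegrable_log (k ^ 2))) (Complex.Gamma (0 + 1))⁻¹
    have hne : ∀ a : ℝ, ∀ᶠ x : ℝ in 𝓝[>] 0, ((x ^ a * Real.log x : ℝ) : ℂ) ≠ 0 := fun a => by
      filter_upwards [Ioo_mem_nhdsGT one_pos] with x hx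
      exact_mod_cast mul_ne_zero (Real.rpow_pos_of_pos hx.1 _).ne'
        (Real.log_neg hx.1 hx.2).ne
    refine ⟨fun g hg => ?_, u, isPrincipal_iff.2 ⟨hu, hL⟩, fun v hv => ?_, fun g hg hind => ?_⟩
    · obtain ⟨W, hW⟩ := hg.exists_wronskian_eq hu
      obtain ⟨h1, e, h2⟩ := hg.tendsto_of_index_zero hu hW hL hc
      exact ⟨isBigO_of_tendsto_div h1 (hne _)
          (Eventually.of_forall fun _ => Complex.norm_real _),
        isBigO_of_tendsto_div h2 (hne _) (Eventually.of_forall fun _ => Complex.norm_real _)⟩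
    · obtain ⟨hv, hLv⟩ := isPrincipal_iff.1 hv
      exact eqOn_of_hasLeadingCoeff le_rfl hQ.1 hc hu hv hL hLv
    · obtain ⟨W, hW⟩ := hg.exists_wronskian_eq hu
      have hW0 := wronskian_ne_zero_of_independent hQ.1 hc hg hu hL hind hW
      exact ⟨_, div_ne_zero (neg_ne_zero.2 hW0) hc, (hg.tendsto_of_index_zero hu hW hL hc).1⟩
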